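/- **Theorem 3.1 ($\Gamma$ only $C^1$).** Let $n\ge 2$, write $x=(x',x_n)\in\mathbb{R}^{n-1}\times\mathbb{R}$ for points of $\mathbb{R}^n$, let $B_r=\{x\in\mathbb{R}^n: |x|<r\}$ and $\Omega=B_1$. Let $\Gamma\subset B_1$ be any closed $C^1$ hypersurface (that is, a compact set which near each of its points is, after a rotation of the coordinates, the graph of a $C^1$ function) such that $$\Gamma\cap B_{1/4}=\Big\{x\in B_{1/4}: x_n=\frac{|x'|}{|\log|x'||}\Big\},$$ where the right-hand side of the equation is read as $0$ for $x'=0$. Call $u\in C(\overline{B_1})$ a distributional solution of $$\Delta u = dH^{n-1}|_{\Gamma}\ \text{ in } B_1,\qquad u=0\ \text{ on }\partial B_1$$ (the case $g\equiv1$ of $\Delta u=g\,dH^{n-1}|_\Gamma$) if $u=0$ on $\partial B_1$ and $$\int_{B_1}u\,\Delta\varphi\,dx=\int_\Gamma \varphi\,dH^{n-1}\qquad\text{for all }\varphi\in C_c^\infty(B_1).$$ Then there is exactly one distributional solution $u$. For all sufficiently small $\varepsilon>0$ it is differentiable at the point $(0,\varepsilon)\in\mathbb{R}^{n-1}\times\mathbb{R}$,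 and $$\lim_{\varepsilon\downarrow0}\partial_{x_n}u(0,\varepsilon)=-\infty .$$ In particular, $u$ is not locally Lipschitz in $B_1$. -/

import Mathlib

open MeasureTheory Metric Set Filter Topology
open scoped ContDiff Laplacian

namespace SurfacePoisson

/-- The part `x' ∈ ℝ^(n-1)` of a point `x = (x', x_n) ∈ ℝ^n`, where `n = d + 1`. -/
noncomputable def horiz {d : ℕ} (x : EuclideanSpace ℝ (Fin (d + 1))) : EuclideanSpace ℝ (Fin d) :=
  WithLp.toLp 2 fun i : Fin d => x i.castSucc

/-- The last coordinate `x_n` of a point `x = (x', x_n) ∈ ℝ^n`, where `n = d + 1`. -/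
def vert {d : ℕ} (x : EuclideanSpace ℝ (Fin (d + 1))) : ℝ :=
  x (Fin.last d)

/-- The standard basis vector `e_n` of `ℝ^n`, where `n = d + 1`. -/
noncomputable def lastVec (d : ℕ) : EuclideanSpace ℝ (Fin (d + 1)) :=
  EuclideanSpace.single (Fin.last d) 1

/-- `Γ` is a closed (that is, compact and without boundary) embedded `C^1` hypersurface of `ℝ^n`,
`n = d + 1`: it is compact, and near each of its points `x₀` it is, in suitable orthonormal
coordinates `y = R x`, the graph `y_n = ψ(y')` of a `C^1` function `ψ`. -/
def IsClosedC1Hypersurface {d : ℕ} (Γ : Set (EuclideanSpace ℝ (Fin (d + 1)))) : Prop :=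
  IsCompact Γ ∧
    ∀ x₀ ∈ Γ, ∃ r : ℝ, 0 < r ∧
      ∃ (R : EuclideanSpace ℝ (Fin (d + 1)) ≃ₗᵢ[ℝ] EuclideanSpace ℝ (Fin (d + 1)))
        (ψ : EuclideanSpace ℝ (Fin d) → ℝ),
        ContDiffOn ℝ 1 ψ (ball (horiz (R x₀)) r) ∧
          Γ ∩ ball x₀ r = {x | x ∈ ball x₀ r ∧ vert (R x) = ψ (horiz (R x))}

/-- `u ∈ C(closure Ω)` is a distributional solution of `Δ u = g dH^(n-1)|_Γ` in `Ω`, `u = 0` on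
`∂Ω`, in `ℝ^n` with `n = d + 1`. Only the values of `u` on `closure Ω` matter.
`μHE[d]` is the `d`-dimensional Hausdorff measure in its usual normalization, in which it is
Lebesgue measure on `ℝ^d`. -/
structure IsDistributionalSolution {d : ℕ} (Ω Γ : Set (EuclideanSpace ℝ (Fin (d + 1))))
    (g u : EuclideanSpace ℝ (Fin (d + 1)) → ℝ) : Prop where
  continuousOn : ContinuousOn u (closure Ω)
  eq_zero_on_frontier : ∀ x ∈ frontier Ω, u x = 0
  weak_eq : ∀ φ : EuclideanSpace ℝ (Fin (d + 1)) → ℝ,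
    ContDiff ℝ ∞ φ → HasCompactSupport φ → tsupport φ ⊆ Ω →
      ∫ x in Ω, u x * (Δ φ) x = ∫ x in Γ, g x * φ x ∂μHE[d]

end SurfacePoisson

/-! Write `n = d + 1`, let `μ` be the surface measure of `Γ`, and let `F` be a primitive of `s ^ (-n
/ 2)`. Up to a constant factor, the Green function of the unit ball is `F(|x - y|²) - F(|y|²|x|² - 2
x·y + 1)`. Both arguments are quadratics `a|x|² - 2 x·b + e`, and `laplacian_radialPot_quadratic`
shows that the Laplacian of `F` of such a quadratic carries the factor `ae - |b|²`. This factor is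
`0` for the reflected term and `δ²` for the singular term regularized as `|x - y|² + δ²`, whose
Laplacian is therefore a rescaled `bubble`, a multiple of an approximate identity.

Locally `Γ` is a Lipschitz graph, so `μ(B_r) ≤ C r ^ d` (`IsClosedC1Hypersurface.exists_hasGrowth`).
This growth makes the regularized potentials of `μ` converge uniformly. The limit is continuous,
vanishes on the sphere and, after normalization, solves the equation. Uniqueness follows by
mollifying the difference of two solutions and applying the maximum principle
(`eq_zero_of_weaklyHarmonic`).

The points `(0, ε)` lie off `Γ`, so the potential can be differentiated there under the integral.
The reflected term contributes a bounded amount; the rest is a positive multiple of `∫ (ε - y_n) /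
|ε e_n - y| ^ n dμ`. The part with numerator `ε` is a Poisson-type integral, bounded uniformly in
`ε` by the growth of `μ`. Near the origin `Γ` lies above its tangent plane, so the part with
numerator `-y_n` has a sign there. Its limit is comparable to `-1 / (|y'| ^ d |log |y'||)`, which is
not integrable on `ℝ ^ d` because `log |log t|` is unbounded at `0`. Fatou's lemma then forces the
derivative to `-∞` (`IsLogCusp.tendsto_integral_vertKernel`). -/

namespace SurfacePoisson

/-! ### Radial potentials composed with quadratics -/

section RadialPot

variable {E : Type*} [NormedAddCommGroup E] [InnerProductSpace ℝ E]

/-- Brings the singular term of the Green function to the same quadratic form as the reflected one,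
so that one derivative formula and one Laplacian formula serve both. -/
lemma norm_sub_sq_add (x y : E) (ε : ℝ) :
    ‖x - y‖ ^ 2 + ε = 1 * ‖x‖ ^ 2 - 2 * inner ℝ x y + (‖y‖ ^ 2 + ε) := by
  rw [norm_sub_sq_real]; ring

lemma hasFDerivAt_quadratic (a e : ℝ) (b x : E) :
    HasFDerivAt (fun z : E => a * ‖z‖ ^ 2 - 2 * inner ℝ z b + e)
      (innerSL ℝ ((2 : ℝ) • (a • x - b))) x := by
  have h1 : HasFDerivAt (fun z : E => ‖z‖ ^ 2) (2 • innerSL ℝ x) x :=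
    (hasStrictFDerivAt_norm_sq x).hasFDerivAt
  have h2 : HasFDerivAt (fun z : E => inner ℝ z b) (innerSL ℝ b) x := by
    have := (innerSL ℝ b).hasFDerivAt (x := x)
    refine this.congr_of_eventuallyEq (Eventually.of_forall fun z => ?_)
    simp [real_inner_comm]
  refine (((h1.const_mul a).sub (h2.const_mul 2)).add_const e).congr_fderiv ?_
  ext w
  simp
  ring

/-- A radial potential in terms of the squared distance `s`: its derivative is `s ^ (-n / 2)`. -/
noncomputable def radialPot (n s : ℝ) : ℝ :=
  if n = 2 then Real.log s else s ^ (1 - n / 2) / (1 - n / 2)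

lemma hasDerivAt_radialPot (n : ℝ) {s : ℝ} (hs : 0 < s) :
    HasDerivAt (radialPot n) (s ^ (-(n / 2))) s := by
  unfold radialPot
  split_ifs with h
  · subst h
    simpa [Real.rpow_neg_one] using Real.hasDerivAt_log hs.ne'
  · have h0 : 1 - n / 2 ≠ 0 := fun h' => h (by linarith)
    refine ((Real.hasDerivAt_rpow_const (p := 1 - n / 2) (Or.inl hs.ne')).div_const
      (1 - n / 2)).congr_deriv ?_
    rw [mul_div_cancel_left₀ _ h0]
    congr 1
    ring

lemma contDiffAt_radialPot (n : ℝ) {s : ℝ} (hs : 0 < s) {k : WithTop ℕ∞} :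
    ContDiffAt ℝ k (radialPot n) s := by
  unfold radialPot
  split_ifs with h
  · exact Real.contDiffAt_log.2 hs.ne'
  · exact (Real.contDiffAt_rpow_const_of_ne hs.ne').div_const _

lemma measurable_radialPot (n : ℝ) : Measurable (radialPot n) := by
  unfold radialPot
  split_ifs with h
  · exact Real.measurable_log
  · fun_prop

lemma contDiffAt_radialPot_quadratic {n a e : ℝ} {b x : E} {k : WithTop ℕ∞}
    (hq : 0 < a * ‖x‖ ^ 2 - 2 * inner ℝ x b + e) :
    ContDiffAt ℝ k (fun z : E => radialPot n (a * ‖z‖ ^ 2 - 2 * inner ℝ z b + e)) x := by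
  refine ContDiffAt.comp (f := fun z : E => a * ‖z‖ ^ 2 - 2 * inner ℝ z b + e) x
    (contDiffAt_radialPot n hq) ?_
  have h1 : ContDiff ℝ k fun z : E => ‖z‖ ^ 2 := contDiff_norm_sq ℝ
  have h2 : ContDiff ℝ k fun z : E => inner ℝ z b := contDiff_id.inner ℝ contDiff_const
  exact (((contDiff_const.mul h1).sub (contDiff_const.mul h2)).add contDiff_const).contDiffAt

lemma hasFDerivAt_radialPot_quadratic {n a e : ℝ} {b x : E}
    (hq : 0 < a * ‖x‖ ^ 2 - 2 * inner ℝ x b + e) :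
    HasFDerivAt (fun z : E => radialPot n (a * ‖z‖ ^ 2 - 2 * inner ℝ z b + e))
      ((a * ‖x‖ ^ 2 - 2 * inner ℝ x b + e) ^ (-(n / 2)) • innerSL ℝ ((2 : ℝ) • (a • x - b))) x :=
  HasDerivAt.comp_hasFDerivAt (f := fun z : E => a * ‖z‖ ^ 2 - 2 * inner ℝ z b + e) x
    (hasDerivAt_radialPot n hq) (hasFDerivAt_quadratic a e b x)

end RadialPot

/-! ### The Laplacian in orthonormal coordinates -/

section Calculus

variable {E : Type*} [NormedAddCommGroup E] [InnerProductSpace ℝ E] [FiniteDimensional ℝ E]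

lemma laplacian_eq_sum_fderiv {ι : Type*} [Fintype ι] (b : OrthonormalBasis ι ℝ E) {f : E → ℝ}
    {x : E} (hf : ContDiffAt ℝ 2 f x) :
    (Δ f) x = ∑ i, fderiv ℝ (fun z => fderiv ℝ f z (b i)) x (b i) := by
  rw [InnerProductSpace.laplacian_eq_iteratedFDeriv_orthonormalBasis f b]
  refine Finset.sum_congr rfl fun i _ => ?_
  have h : DifferentiableAt ℝ (fderiv ℝ f) x :=
    (hf.fderiv_right (m := 1) (by norm_num)).differentiableAt (by norm_num)
  rw [iteratedFDeriv_two_apply, fderiv_clm_apply h (by fun_prop)]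
  simp

lemma continuousAt_laplacian {f : E → ℝ} {x : E} (hf : ContDiffAt ℝ 2 f x) :
    ContinuousAt (Δ f) x := by
  rw [InnerProductSpace.laplacian_eq_iteratedFDeriv_stdOrthonormalBasis f]
  refine tendsto_finsetSum _ fun i _ => ?_
  have h := hf.continuousAt_iteratedFDeriv (k := 2) le_rfl
  exact (ContinuousMultilinearMap.apply ℝ (fun _ : Fin 2 => E) ℝ _).continuous.continuousAt.comp h

lemma laplacian_eq_zero_of_notMem_tsupport {f : E → ℝ} {x : E} (hx : x ∉ tsupport f) :
    (Δ f) x = 0 := by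
  have h : f =ᶠ[𝓝 x] fun _ => (0 : ℝ) := notMem_tsupport_iff_eventuallyEq.1 hx
  rw [(InnerProductSpace.laplacian_congr_nhds h).eq_of_nhds]
  simp

lemma support_laplacian_subset {f : E → ℝ} : Function.support (Δ f) ⊆ tsupport f := fun x hx => by
  by_contra h
  exact hx (laplacian_eq_zero_of_notMem_tsupport h)

lemma laplacian_comp_const_sub {η : E → ℝ} (hη : ContDiff ℝ 2 η) (x t : E) :
    (Δ (fun s => η (x - s))) t = (Δ η) (x - t) := by
  set β := stdOrthonormalBasis ℝ E
  have hsub : ∀ {g : E → ℝ}, Differentiable ℝ g → ∀ s e : E,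
      fderiv ℝ (fun s => g (x - s)) s e = -fderiv ℝ g (x - s) e := fun hg s e => by
    have h1 : HasFDerivAt (fun s : E => x - s) (-ContinuousLinearMap.id ℝ E) s :=
      (hasFDerivAt_id s).const_sub x
    have h2 := (hg (x - s)).hasFDerivAt.comp s h1
    refine (congrArg (fun L : E →L[ℝ] ℝ => L e) h2.fderiv).trans ?_
    simp
  have hc : ContDiff ℝ 2 fun s => η (x - s) := hη.comp (contDiff_const.sub contDiff_id)
  rw [laplacian_eq_sum_fderiv β hη.contDiffAt, laplacian_eq_sum_fderiv β hc.contDiffAt]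
  refine Finset.sum_congr rfl fun i _ => ?_
  have hd : ContDiff ℝ 1 fun y => fderiv ℝ η y (β i) :=
    (hη.fderiv_right (by norm_num)).clm_apply contDiff_const
  simp_rw [hsub (hη.differentiable (by norm_num))]
  have h3 := hsub (hd.differentiable (by norm_num)).neg t (β i)
  simp only [Pi.neg_apply] at h3
  rw [h3]
  have h4 : fderiv ℝ (-fun y => fderiv ℝ η y (β i)) (x - t) =
    -fderiv ℝ (fun y => fderiv ℝ η y (β i)) (x - t) := fderiv_neg
  rw [h4]
  simp

/-- The Laplacian is nonpositive at a local maximum. -/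
lemma laplacian_nonpos_of_isLocalMax {f : E → ℝ} {x : E} (hf : ContDiffAt ℝ 2 f x)
    (hmax : IsLocalMax f x) : (Δ f) x ≤ 0 := by
  rw [laplacian_eq_sum_fderiv (stdOrthonormalBasis ℝ E) hf]
  refine Finset.sum_nonpos fun i _ => ?_
  set e := stdOrthonormalBasis ℝ E i
  set g : ℝ → ℝ := fun t => f (x + t • e) with hg
  have hline : ∀ t : ℝ, HasDerivAt (fun t : ℝ => x + t • e) e t := fun t => by
    simpa using ((hasDerivAt_id t).smul_const e).const_add x
  have hcl : Tendsto (fun t : ℝ => x + t • e) (𝓝 0) (𝓝 x) := by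
    have : Continuous fun t : ℝ => x + t • e := by fun_prop
    simpa using this.tendsto 0
  have hgmax : IsLocalMax g 0 := by
    have := hcl.eventually hmax
    filter_upwards [this] with t ht
    simpa [hg] using ht
  have hdiff : ∀ᶠ t : ℝ in 𝓝 0, HasDerivAt g (fderiv ℝ f (x + t • e) e) t := by
    have h1 : ∀ᶠ z in 𝓝 x, DifferentiableAt ℝ f z := by
      filter_upwards [hf.eventually (by norm_num)] with z hz using hz.differentiableAt (by norm_num)
    filter_upwards [hcl.eventually h1] with t ht
    exact ht.hasFDerivAt.comp_hasDerivAt t (hline t)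
  have hd : DifferentiableAt ℝ (fun z => fderiv ℝ f z e) x :=
    ((hf.fderiv_right (m := 1) (by norm_num)).differentiableAt (by norm_num)).clm_apply
      (differentiableAt_const e)
  have hdd : deriv (deriv g) 0 = fderiv ℝ (fun z => fderiv ℝ f z e) x e := by
    have h1 : deriv g =ᶠ[𝓝 0] fun t : ℝ => fderiv ℝ f (x + t • e) e := by
      filter_upwards [hdiff] with t ht using ht.deriv
    rw [h1.deriv_eq]
    have h2 : HasFDerivAt (fun z => fderiv ℝ f z e) (fderiv ℝ (fun z => fderiv ℝ f z e) x)
      (x + (0 : ℝ) • e) := by simpa using hd.hasFDerivAt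
    exact (h2.comp_hasDerivAt 0 (hline 0)).deriv
  -- A positive second derivative would make `0` a strict-type minimum as well as a maximum of `g`;
  -- then `g` is locally constant and its second derivative vanishes.
  by_contra! hpos
  rw [← hdd] at hpos
  have hmin := isLocalMin_of_deriv_deriv_pos hpos hgmax.deriv_eq_zero
    hdiff.self_of_nhds.continuousAt
  have hconst : g =ᶠ[𝓝 0] fun _ => g 0 := by
    filter_upwards [hgmax, hmin] with t h1 h2 using le_antisymm h1 h2
  have : deriv (deriv g) 0 = 0 := by
    have h1 : deriv g =ᶠ[𝓝 0] fun _ => (0 : ℝ) := by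
      have := hconst.deriv
      simpa using this
    rw [h1.deriv_eq]; simp
  exact hpos.ne' this

/-- With `q` the quadratic, `|ax - b|² = a q + |b|² - a e`. The `a q` part cancels against the term
from the second derivatives of `q`, exactly because the exponent `-n / 2` matches the dimension.
Only the discriminant `ae - |b|²` survives. -/
lemma laplacian_radialPot_quadratic {a e : ℝ} {b x : E}
    (hq : 0 < a * ‖x‖ ^ 2 - 2 * inner ℝ x b + e) :
    (Δ (fun z : E => radialPot (Module.finrank ℝ E) (a * ‖z‖ ^ 2 - 2 * inner ℝ z b + e))) x =
      2 * (Module.finrank ℝ E : ℝ) * (a * e - ‖b‖ ^ 2) *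
        (a * ‖x‖ ^ 2 - 2 * inner ℝ x b + e) ^ (-((Module.finrank ℝ E : ℝ) / 2) - 1) := by
  set n : ℝ := ((Module.finrank ℝ E : ℕ) : ℝ) with hn
  set q : E → ℝ := fun z => a * ‖z‖ ^ 2 - 2 * inner ℝ z b + e with hqdef
  have hq' : 0 < q x := hq
  change _ = 2 * n * (a * e - ‖b‖ ^ 2) * q x ^ (-(n / 2) - 1)
  have hcont : Continuous q := by fun_prop
  set β := stdOrthonormalBasis ℝ E
  rw [laplacian_eq_sum_fderiv β (contDiffAt_radialPot_quadratic hq)]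
  have hpow : HasFDerivAt (fun z => q z ^ (-(n / 2)))
      ((-(n / 2) * q x ^ (-(n / 2) - 1)) • innerSL ℝ ((2 : ℝ) • (a • x - b))) x :=
    (Real.hasDerivAt_rpow_const (Or.inl hq'.ne')).comp_hasFDerivAt x
      (hasFDerivAt_quadratic a e b x)
  have hterm : ∀ i, fderiv ℝ (fun z => fderiv ℝ (fun z : E => radialPot n (q z)) z (β i)) x (β i) =
      -(n / 2) * q x ^ (-(n / 2) - 1) * 4 * (inner ℝ (a • x - b) (β i)) ^ 2 +
        q x ^ (-(n / 2)) * (2 * a) := fun i => by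
    have h1 : (fun z => fderiv ℝ (fun z : E => radialPot n (q z)) z (β i)) =ᶠ[𝓝 x]
        fun z => q z ^ (-(n / 2)) * (2 * (a * inner ℝ (β i) z - inner ℝ b (β i))) := by
      filter_upwards [hcont.continuousAt.eventually (lt_mem_nhds hq')] with z hz
      rw [(hasFDerivAt_radialPot_quadratic (n := n) hz).fderiv]
      simp [real_inner_comm, hqdef]
    rw [h1.fderiv_eq]
    have h2 : HasFDerivAt (fun z : E => 2 * (a * inner ℝ (β i) z - inner ℝ b (β i)))
        ((2 : ℝ) • a • innerSL ℝ (β i)) x :=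
      ((((innerSL ℝ (β i)).hasFDerivAt (x := x)).const_mul a).sub_const _).const_mul 2
    refine (congrArg (fun L : E →L[ℝ] ℝ => L (β i)) (hpow.mul h2).fderiv).trans ?_
    simp [inner_sub_left, inner_smul_left, real_inner_comm]
    ring
  refine (Finset.sum_congr rfl fun i _ => hterm i).trans ?_
  rw [Finset.sum_add_distrib, ← Finset.mul_sum]
  have hpars : ∑ i, (inner ℝ (a • x - b) (β i)) ^ 2 = ‖a • x - b‖ ^ 2 := by
    have := β.sum_sq_norm_inner_left (a • x - b)
    simpa using this
  have hexp : ‖a • x - b‖ ^ 2 = a * q x + ‖b‖ ^ 2 - a * e := by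
    rw [norm_sub_sq_real, norm_smul, inner_smul_left, mul_pow, Real.norm_eq_abs, sq_abs]
    simp [hqdef]
    ring
  rw [hpars, hexp]
  simp only [Finset.sum_const, Finset.card_univ, Fintype.card_fin, nsmul_eq_mul, ← hn]
  have hsplit : q x ^ (-(n / 2)) = q x ^ (-(n / 2) - 1) * q x := by
    rw [Real.rpow_sub_one hq'.ne', div_mul_cancel₀ _ hq'.ne']
  rw [hsplit]
  ring

end Calculus

/-- A function which is continuous near the support of a factor has a continuous product. -/
lemma continuous_mul_of_tsupport {X : Type*} [TopologicalSpace X] {f φ : X → ℝ} {K : Set X} (hK : IsClosed K)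
    (hφK : Function.support φ ⊆ K) (hφ : Continuous φ)
    (hf : ∀ x ∈ K, ContinuousAt f x) : Continuous fun x => f x * φ x := by
  rw [continuous_iff_continuousAt]
  intro x
  by_cases hx : x ∈ K
  · exact (hf x hx).mul hφ.continuousAt
  · have h : (fun x => f x * φ x) =ᶠ[𝓝 x] fun _ => 0 := by
      filter_upwards [hK.isOpen_compl.mem_nhds hx] with z hz
      have : φ z = 0 := by
        by_contra h0
        exact hz (hφK h0)
      simp [this]
    exact continuousAt_const.congr h.symm

/-! ### Green's second identity -/

section Green

variable {E : Type*} [NormedAddCommGroup E] [InnerProductSpace ℝ E] [FiniteDimensional ℝ E]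
  [MeasurableSpace E] [BorelSpace E]

lemma integral_fderiv_apply_eq_zero {g : E → ℝ} (hg : ContDiff ℝ 1 g) (hc : HasCompactSupport g)
    (v : E) : ∫ x, fderiv ℝ g x v = 0 := by
  have h := integral_mul_fderiv_eq_neg_fderiv_mul_of_integrable (μ := (volume : Measure E))
    (f := fun _ : E => (1 : ℝ)) (g := g) (v := v) (by simp) ?_ ?_ (fun x _ => by fun_prop)
    (fun x _ => (hg.differentiable (by norm_num)) x)
  · simpa using h
  · simp only [one_mul]
    refine Continuous.integrable_of_hasCompactSupport ?_ (hc.fderiv_apply ℝ v)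
    exact (hg.continuous_fderiv (by norm_num)).clm_apply continuous_const
  · simpa using hg.continuous.integrable_of_hasCompactSupport hc

/-- Green's second identity for a compactly supported factor. -/
lemma integral_mul_laplacian_eq {f φ : E → ℝ} (hφ : ContDiff ℝ 2 φ) (hc : HasCompactSupport φ)
    (hf : ∀ x ∈ tsupport φ, ContDiffAt ℝ 2 f x) :
    ∫ x, f x * (Δ φ) x = ∫ x, (Δ f) x * φ x := by
  set β := stdOrthonormalBasis ℝ E
  have hfc : ∀ x ∈ tsupport φ, ContinuousAt f x := fun x hx => (hf x hx).continuousAt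
  have hΔφ : Continuous (Δ φ) := continuous_iff_continuousAt.2 fun x =>
    continuousAt_laplacian hφ.contDiffAt
  have hcs : ∀ {ψ : E → ℝ}, (∀ x ∉ tsupport φ, ψ x = 0) → HasCompactSupport ψ := fun h =>
    HasCompactSupport.intro hc h
  have hi1 : Integrable fun x => f x * (Δ φ) x :=
    (continuous_mul_of_tsupport (isClosed_tsupport φ) support_laplacian_subset hΔφ
      hfc).integrable_of_hasCompactSupport
      (hcs fun x hx => by simp [laplacian_eq_zero_of_notMem_tsupport hx])
  have hi2 : Integrable fun x => (Δ f) x * φ x :=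
    (continuous_mul_of_tsupport (isClosed_tsupport φ) (subset_tsupport φ) hφ.continuous
      fun x hx => continuousAt_laplacian (hf x hx)).integrable_of_hasCompactSupport
      (hcs fun x hx => by simp [image_eq_zero_of_notMem_tsupport hx])
  rw [← sub_eq_zero, ← integral_sub hi1 hi2]
  -- Components of the Green vector field `f ∇φ - φ ∇f`. It is `C^1` on the whole space, although
  -- `f` is regular only near the support of `φ`, because it vanishes off that support.
  set G : Fin (Module.finrank ℝ E) → E → ℝ := fun i z =>
    f z * fderiv ℝ φ z (β i) - fderiv ℝ f z (β i) * φ z with hG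
  have hG0 : ∀ i, ∀ x ∉ tsupport φ, G i =ᶠ[𝓝 x] fun _ => 0 := fun i x hx => by
    filter_upwards [(isClosed_tsupport φ).isOpen_compl.mem_nhds hx] with z hz
    have h1 : fderiv ℝ φ z = 0 := by
      have : φ =ᶠ[𝓝 z] fun _ => (0 : ℝ) := notMem_tsupport_iff_eventuallyEq.1 hz
      rw [this.fderiv_eq]; simp
    simp [hG, h1, image_eq_zero_of_notMem_tsupport hz]
  have hGd : ∀ i, ContDiff ℝ 1 (G i) := fun i => by
    rw [contDiff_iff_contDiffAt]
    intro x
    by_cases hx : x ∈ tsupport φ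
    · have h1 : ContDiffAt ℝ 1 (fderiv ℝ φ) x := hφ.contDiffAt.fderiv_right (by norm_num)
      have h2 : ContDiffAt ℝ 1 (fderiv ℝ f) x := (hf x hx).fderiv_right (by norm_num)
      exact (((hf x hx).of_le (by norm_num)).mul (h1.clm_apply contDiffAt_const)).sub
        ((h2.clm_apply contDiffAt_const).mul (hφ.contDiffAt.of_le (by norm_num)))
    · exact contDiffAt_const.congr_of_eventuallyEq (hG0 i x hx)
  have hGc : ∀ i, HasCompactSupport (G i) := fun i =>
    hcs fun x hx => (hG0 i x hx).self_of_nhds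
  have hsum : ∀ x, f x * (Δ φ) x - (Δ f) x * φ x = ∑ i, fderiv ℝ (G i) x (β i) := fun x => by
    by_cases hx : x ∈ tsupport φ
    · rw [laplacian_eq_sum_fderiv β hφ.contDiffAt, laplacian_eq_sum_fderiv β (hf x hx),
        Finset.mul_sum, Finset.sum_mul, ← Finset.sum_sub_distrib]
      refine Finset.sum_congr rfl fun i _ => ?_
      have h1 : DifferentiableAt ℝ (fun z => fderiv ℝ φ z (β i)) x :=
        ((hφ.contDiffAt.fderiv_right (m := 1) (by norm_num)).differentiableAt
          (by norm_num)).clm_apply (by fun_prop)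
      have h2 : DifferentiableAt ℝ (fun z => fderiv ℝ f z (β i)) x :=
        (((hf x hx).fderiv_right (m := 1) (by norm_num)).differentiableAt
          (by norm_num)).clm_apply (by fun_prop)
      have h3 : DifferentiableAt ℝ f x := (hf x hx).differentiableAt (by norm_num)
      have h4 : DifferentiableAt ℝ φ x := hφ.contDiffAt.differentiableAt (by norm_num)
      refine Eq.trans ?_ (congrArg (fun L : E →L[ℝ] ℝ => L (β i))
        ((h3.hasFDerivAt.mul h1.hasFDerivAt).sub (h2.hasFDerivAt.mul h4.hasFDerivAt)).fderiv).symm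
      simp
      ring
    · rw [laplacian_eq_zero_of_notMem_tsupport hx, image_eq_zero_of_notMem_tsupport hx,
        Finset.sum_eq_zero fun i _ => by rw [(hG0 i x hx).fderiv_eq]; simp]
      simp
  simp_rw [hsum]
  rw [integral_finsetSum _ fun i _ => ?_]
  · exact Finset.sum_eq_zero fun i _ => integral_fderiv_apply_eq_zero (hGd i) (hGc i) _
  · exact (((hGd i).continuous_fderiv (by norm_num)).clm_apply
      continuous_const).integrable_of_hasCompactSupport ((hGc i).fderiv_apply ℝ _)

end Green

/-! ### The weak maximum principle -/

section MaximumPrinciple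

variable {E : Type*} [NormedAddCommGroup E] [InnerProductSpace ℝ E] [FiniteDimensional ℝ E]

/-- The weak maximum principle on a ball. -/
lemma le_of_laplacian_nonneg [Nontrivial E] {v : E → ℝ} {R M : ℝ}
    (hv : ContDiff ℝ 2 v) (hΔ : ∀ x ∈ ball (0 : E) R, 0 ≤ (Δ v) x)
    (hM : ∀ x ∈ sphere (0 : E) R, v x ≤ M) {x : E} (hx : x ∈ closedBall (0 : E) R) : v x ≤ M := by
  have key : ∀ κ : ℝ, 0 < κ → v x ≤ M + κ * R ^ 2 := fun κ hκ => by
    -- The added `κ ‖z‖²` makes the Laplacian strictly positive, which excludes an interior maximum.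
    set w : E → ℝ := fun z => v z + κ * ‖z‖ ^ 2 with hw
    have hsq : ContDiff ℝ 2 fun z : E => κ * ‖z‖ ^ 2 := contDiff_const.mul (contDiff_norm_sq ℝ)
    have hwc : ContDiff ℝ 2 w := hv.add hsq
    obtain ⟨y, hy, hmax⟩ := (isCompact_closedBall (0 : E) R).exists_isMaxOn ⟨x, hx⟩
      hwc.continuous.continuousOn
    have hyx : w x ≤ w y := hmax hx
    have hxw : v x ≤ w x := by simp only [hw]; nlinarith [sq_nonneg ‖x‖]
    have hyn : ‖y‖ ≤ R := by simpa using hy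
    rcases hyn.lt_or_eq with hlt | heq
    · exfalso
      have hyb : y ∈ ball (0 : E) R := by simpa using hlt
      have hloc : IsLocalMax w y := hmax.isLocalMax (closedBall_mem_nhds_of_mem hyb)
      have h1 := laplacian_nonpos_of_isLocalMax hwc.contDiffAt hloc
      have h2 : (Δ w) y = (Δ v) y + (Δ (fun z : E => κ * ‖z‖ ^ 2)) y :=
        ContDiffAt.laplacian_add hv.contDiffAt hsq.contDiffAt
      have h3 : (Δ (fun z : E => κ * ‖z‖ ^ 2)) y = 2 * κ * Module.finrank ℝ E := by
        set β := stdOrthonormalBasis ℝ E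
        rw [laplacian_eq_sum_fderiv β hsq.contDiffAt]
        have : ∀ i, fderiv ℝ (fun z => fderiv ℝ (fun z : E => κ * ‖z‖ ^ 2) z (β i)) y (β i) =
            2 * κ := fun i => by
          have e1 : (fun z => fderiv ℝ (fun z : E => κ * ‖z‖ ^ 2) z (β i)) =
              fun z => (2 * κ) * inner ℝ (β i) z := by
            funext z
            rw [((hasStrictFDerivAt_norm_sq z).hasFDerivAt.const_mul κ).fderiv]
            simp [real_inner_comm]
            ring
          rw [e1]
          have e2 : HasFDerivAt (fun z : E => (2 * κ) * inner ℝ (β i) z)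
              ((2 * κ) • innerSL ℝ (β i)) y := ((innerSL ℝ (β i)).hasFDerivAt).const_mul _
          rw [e2.fderiv]
          simp
        simp [this]
        ring
      have h4 : (0 : ℝ) < Module.finrank ℝ E := by exact_mod_cast Module.finrank_pos
      have := hΔ y hyb
      have : 0 < 2 * κ * Module.finrank ℝ E := by positivity
      linarith
    · have := hM y (by simpa using heq)
      have hwy : w y ≤ M + κ * R ^ 2 := by simp only [hw, heq]; linarith
      linarith
  by_contra! hlt
  have hR2 : 0 < R ^ 2 + 1 := by positivity
  -- This `κ` gives `κ R² ≤ (v x - M) / 2`; the `+ 1` covers `R = 0`.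
  have := key ((v x - M) / (R ^ 2 + 1) / 2) (by have := sub_pos.2 hlt; positivity)
  have h5 : (v x - M) / (R ^ 2 + 1) / 2 * R ^ 2 ≤ (v x - M) / 2 := by
    rw [div_div, div_mul_eq_mul_div, div_le_div_iff₀ (by positivity) (by positivity)]
    nlinarith [sub_pos.2 hlt]
  linarith [sub_pos.2 hlt]

end MaximumPrinciple

lemma two_le_infty : (2 : WithTop ℕ∞) ≤ ∞ := WithTop.coe_le_coe.2 le_top

/-! ### Uniqueness: weakly harmonic functions by mollification -/

section Mollification

variable {E : Type*} [NormedAddCommGroup E] [InnerProductSpace ℝ E] [FiniteDimensional ℝ E]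
  [MeasurableSpace E] [BorelSpace E]

open scoped Convolution

lemma fderiv_convolution_apply {η W : E → ℝ} (hη : ContDiff ℝ 1 η) (hc : HasCompactSupport η)
    (hW : Continuous W) (e z : E) :
    fderiv ℝ (η ⋆[ContinuousLinearMap.lsmul ℝ ℝ, volume] W) z e =
      ((fun y => fderiv ℝ η y e) ⋆[ContinuousLinearMap.lsmul ℝ ℝ, volume] W) z := by
  have hcl := hW.locallyIntegrable (μ := (volume : Measure E))
  rw [(hc.hasFDerivAt_convolution_left (ContinuousLinearMap.lsmul ℝ ℝ) hη hcl z).fderiv]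
  have hex := (hc.fderiv ℝ).convolutionExists_left
    ((ContinuousLinearMap.lsmul ℝ ℝ).precompL E (𝕜 := ℝ)) (μ := volume)
    (hη.continuous_fderiv (by norm_num)) hcl z
  unfold convolution
  rw [ContinuousLinearMap.integral_apply hex]
  simp

/-- All derivatives fall on `η`, as `W` is merely continuous. The right side pairs `W` with the
Laplacian of a reflected translate of `η`, which is what a weak equation can test. -/
lemma laplacian_convolution {η W : E → ℝ} (hη : ContDiff ℝ 2 η) (hc : HasCompactSupport η)
    (hW : Continuous W) (x : E) :
    (Δ (η ⋆[ContinuousLinearMap.lsmul ℝ ℝ, volume] W)) x = ∫ t, W t * (Δ η) (x - t) := by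
  have hcl := hW.locallyIntegrable (μ := (volume : Measure E))
  set β := stdOrthonormalBasis ℝ E
  have hconv : ContDiff ℝ 2 (η ⋆[ContinuousLinearMap.lsmul ℝ ℝ, volume] W) :=
    hc.contDiff_convolution_left _ (n := 2) hη hcl
  have hd : ∀ i, ContDiff ℝ 1 fun y => fderiv ℝ η y (β i) := fun i =>
    (hη.fderiv_right (by norm_num)).clm_apply contDiff_const
  rw [laplacian_eq_sum_fderiv β hconv.contDiffAt]
  have h1 : ∀ i, fderiv ℝ (fun z => fderiv ℝ
      (η ⋆[ContinuousLinearMap.lsmul ℝ ℝ, volume] W) z (β i)) x (β i) =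
      ∫ t, W t * fderiv ℝ (fun y => fderiv ℝ η y (β i)) (x - t) (β i) := fun i => by
    have h2 : (fun z => fderiv ℝ (η ⋆[ContinuousLinearMap.lsmul ℝ ℝ, volume] W) z (β i)) =
        (fun y => fderiv ℝ η y (β i)) ⋆[ContinuousLinearMap.lsmul ℝ ℝ, volume] W :=
      funext fun z => fderiv_convolution_apply (hη.of_le (by norm_num)) hc hW _ z
    rw [h2, fderiv_convolution_apply (hd i) (hc.fderiv_apply ℝ _) hW, convolution_eq_swap]
    simp [mul_comm]
  simp_rw [h1]
  rw [← integral_finsetSum]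
  · refine integral_congr_ae (Eventually.of_forall fun t => ?_)
    simp only
    rw [laplacian_eq_sum_fderiv β hη.contDiffAt, Finset.mul_sum]
  · intro i _
    refine Continuous.integrable_of_hasCompactSupport ?_ ?_
    · exact hW.mul ((((hd i).continuous_fderiv (by norm_num)).comp
        (continuous_const.sub continuous_id)).clm_apply continuous_const)
    · have h3 : HasCompactSupport fun y => fderiv ℝ (fun y => fderiv ℝ η y (β i)) y (β i) :=
        (hc.fderiv_apply ℝ (β i)).fderiv_apply ℝ (β i)
      exact (h3.comp_homeomorph (Homeomorph.subLeft x)).mul_left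

/-- A continuous weakly harmonic function on the unit ball with zero boundary values is bounded
above by `0`. -/
lemma nonpos_of_weaklyHarmonic [Nontrivial E] {w : E → ℝ}
    (hw : ContinuousOn w (closedBall (0 : E) 1)) (hw0 : ∀ x ∈ sphere (0 : E) 1, w x = 0)
    (hweak : ∀ φ : E → ℝ, ContDiff ℝ ∞ φ → HasCompactSupport φ → tsupport φ ⊆ ball 0 1 →
      ∫ x in ball 0 1, w x * (Δ φ) x = 0) {x : E} (hx : x ∈ ball (0 : E) 1) : w x ≤ 0 := by
  -- The zero boundary values make the extension by zero continuous, so it can be mollified on the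
  -- whole space.
  set W : E → ℝ := (ball (0 : E) 1).indicator w with hWdef
  have hW : Continuous W := by
    refine continuous_indicator (fun a ha => hw0 a ?_) ?_
    · rwa [frontier_ball (0 : E) one_ne_zero] at ha
    · rwa [closure_ball (0 : E) one_ne_zero]
  have hWc : HasCompactSupport W := by
    refine HasCompactSupport.intro (isCompact_closedBall (0 : E) 1) fun z hz => ?_
    exact indicator_of_notMem (fun h => hz (ball_subset_closedBall h)) _
  have hWu : UniformContinuous W := hWc.uniformContinuous_of_continuous hW
  refine le_of_forall_pos_le_add fun κ hκ => ?_
  obtain ⟨δ₀, hδ₀, hu⟩ := Metric.uniformContinuous_iff.1 hWu (κ / 3) (by positivity)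
  obtain ⟨δ, hδ, hδ1, hδ2⟩ : ∃ δ : ℝ, 0 < δ ∧ 2 * δ < δ₀ ∧ 2 * δ < 1 :=
    ⟨min δ₀ 1 / 4, by positivity, by linarith [min_le_left δ₀ 1], by linarith [min_le_right δ₀ 1]⟩
  -- A point of the shell is within `2 * δ` of its radial projection to the sphere, where `W`
  -- vanishes.
  have hshell : ∀ z : E, 1 - 2 * δ ≤ ‖z‖ → |W z| ≤ κ / 3 := fun z hz => by
    by_cases hz1 : z ∈ ball (0 : E) 1
    · have hzn : ‖z‖ < 1 := by simpa using hz1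
      have hz0 : 0 < ‖z‖ := by linarith
      set y : E := (‖z‖⁻¹ : ℝ) • z
      have hy : ‖y‖ = 1 := by
        rw [norm_smul, norm_inv, norm_norm, inv_mul_cancel₀ hz0.ne']
      have hWy : W y = 0 := indicator_of_notMem (by simp [hy]) _
      have hdist : dist z y < δ₀ := by
        have : z - y = (1 - ‖z‖⁻¹) • z := by simp [y, sub_smul]
        rw [dist_eq_norm, this, norm_smul, Real.norm_eq_abs, ← abs_of_pos hz0, ← abs_mul,
          abs_of_pos hz0, sub_mul, inv_mul_cancel₀ hz0.ne', abs_lt]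
        constructor <;> linarith
      have := hu hdist
      rw [hWy, Real.dist_eq, sub_zero] at this
      exact this.le
    · rw [hWdef, indicator_of_notMem hz1]
      simp; positivity
  have hWx : W x = w x := indicator_of_mem hx _
  rw [zero_add, ← hWx]
  rcases le_or_gt (1 - 2 * δ) ‖x‖ with hbig | hsmall
  · have := hshell x hbig
    linarith [le_abs_self (W x)]
  · set bump : ContDiffBump (0 : E) := ⟨δ / 2, δ, by positivity, by linarith⟩
    set η : E → ℝ := bump.normed volume
    have hη : ContDiff ℝ ∞ η := bump.contDiff_normed
    have hηc : HasCompactSupport η := bump.hasCompactSupport_normed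
    have hη2 : ContDiff ℝ 2 η := hη.of_le two_le_infty
    set v : E → ℝ := η ⋆[ContinuousLinearMap.lsmul ℝ ℝ, volume] W
    have hvW : ∀ z, |v z - W z| ≤ κ / 3 := fun z => by
      rw [← Real.dist_eq]
      refine bump.dist_normed_convolution_le hW.aestronglyMeasurable fun y hy => (hu ?_).le
      have : dist y z < δ := hy
      linarith
    have hv : ContDiff ℝ 2 v :=
      hηc.contDiff_convolution_left _ (n := 2) hη2 (hW.locallyIntegrable)
    have hΔ : ∀ z ∈ ball (0 : E) (1 - 2 * δ), 0 ≤ (Δ v) z := fun z hz => by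
      have hz' : ‖z‖ < 1 - 2 * δ := by simpa using hz
      rw [laplacian_convolution hη2 hηc hW]
      -- The mollifier has radius `δ` and `z` is at distance more than `2 * δ` from the sphere, so
      -- `φ` is an admissible test function.
      set φ : E → ℝ := fun s => η (z - s)
      have hφs : tsupport φ ⊆ closedBall z δ := by
        refine closure_minimal (fun s hs => ?_) isClosed_closedBall
        have h1 : z - s ∈ Function.support η := hs
        rw [bump.support_normed_eq] at h1
        have : ‖z - s‖ < δ := by simpa using h1
        rw [mem_closedBall, dist_comm, dist_eq_norm]
        exact this.le
      have hφb : tsupport φ ⊆ ball 0 1 := hφs.trans fun s hs => by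
        have h1 : ‖s - z‖ ≤ δ := by simpa [dist_eq_norm] using hs
        have h2 := norm_add_le (s - z) z
        rw [sub_add_cancel] at h2
        simp only [mem_ball, dist_zero_right]
        linarith
      have hφ := hweak φ (hη.comp (contDiff_const.sub contDiff_id))
        (hηc.comp_homeomorph (Homeomorph.subLeft z)) hφb
      rw [← integral_indicator measurableSet_ball] at hφ
      refine (hφ.symm.trans (integral_congr_ae (Eventually.of_forall fun t => ?_))).le
      simp only [hWdef]
      by_cases ht : t ∈ ball (0 : E) 1
      · rw [indicator_of_mem ht, indicator_of_mem ht, laplacian_comp_const_sub hη2]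
      · rw [indicator_of_notMem ht, indicator_of_notMem ht, zero_mul]
    -- On the sphere of radius `1 - 2 * δ`, one `κ / 3` comes from the shell bound and one from the
    -- mollification error.
    have hle : v x ≤ 2 * κ / 3 := by
      refine le_of_laplacian_nonneg hv hΔ (fun z hz => ?_)
        (x := x) (by simpa using hsmall.le)
      have hz' : ‖z‖ = 1 - 2 * δ := by simpa using hz
      have h1 := hshell z hz'.ge
      have h2 := hvW z
      rw [abs_le] at h1 h2
      linarith
    have := hvW x
    rw [abs_le] at this
    linarith

/-- A continuous weakly harmonic function on the unit ball with zero boundary values vanishes. -/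
theorem eq_zero_of_weaklyHarmonic [Nontrivial E] {w : E → ℝ}
    (hw : ContinuousOn w (closedBall (0 : E) 1)) (hw0 : ∀ x ∈ sphere (0 : E) 1, w x = 0)
    (hweak : ∀ φ : E → ℝ, ContDiff ℝ ∞ φ → HasCompactSupport φ → tsupport φ ⊆ ball 0 1 →
      ∫ x in ball 0 1, w x * (Δ φ) x = 0) {x : E} (hx : x ∈ closedBall (0 : E) 1) : w x = 0 := by
  rw [← ball_union_sphere] at hx
  rcases hx with hx | hx
  · refine le_antisymm (nonpos_of_weaklyHarmonic hw hw0 hweak hx) ?_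
    have := nonpos_of_weaklyHarmonic (w := fun z => -w z) hw.neg (fun z hz => by simp [hw0 z hz])
      (fun φ h1 h2 h3 => by simp [integral_neg, hweak φ h1 h2 h3]) hx
    simpa using this
  · exact hw0 x hx

end Mollification

lemma IsDistributionalSolution.eqOn {d : ℕ} {Γ : Set (EuclideanSpace ℝ (Fin (d + 1)))}
    {g u v : EuclideanSpace ℝ (Fin (d + 1)) → ℝ} (hu : IsDistributionalSolution (ball 0 1) Γ g u)
    (hv : IsDistributionalSolution (ball 0 1) Γ g v) : EqOn u v (closure (ball 0 1)) := by
  intro x hx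
  have hcl : closure (ball (0 : EuclideanSpace ℝ (Fin (d + 1))) 1) = closedBall 0 1 :=
    closure_ball _ one_ne_zero
  have hfr : frontier (ball (0 : EuclideanSpace ℝ (Fin (d + 1))) 1) = sphere 0 1 :=
    frontier_ball _ one_ne_zero
  have hint : ∀ {w : EuclideanSpace ℝ (Fin (d + 1)) → ℝ}, ContinuousOn w (closedBall 0 1) →
      ∀ {φ : EuclideanSpace ℝ (Fin (d + 1)) → ℝ}, ContDiff ℝ ∞ φ →
      IntegrableOn (fun x => w x * (Δ φ) x) (ball 0 1) := fun hw φ hφ => by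
    have hφ2 : ContDiff ℝ 2 φ := hφ.of_le two_le_infty
    have hΔ : Continuous (Δ φ) := continuous_iff_continuousAt.2 fun x =>
      continuousAt_laplacian hφ2.contDiffAt
    exact ((hw.mul hΔ.continuousOn).integrableOn_compact (isCompact_closedBall 0 1)).mono_set
      ball_subset_closedBall
  have hu' := hu.continuousOn
  have hv' := hv.continuousOn
  rw [hcl] at hu' hv' hx
  refine sub_eq_zero.1 (eq_zero_of_weaklyHarmonic (w := fun z => u z - v z) (hu'.sub hv')
    (fun z hz => ?_) (fun φ h1 h2 h3 => ?_) hx)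
  · rw [← hfr] at hz
    rw [hu.eq_zero_on_frontier z hz, hv.eq_zero_on_frontier z hz, sub_zero]
  · simp_rw [sub_mul]
    rw [integral_sub (hint hu' h1) (hint hv' h1), hu.weak_eq φ h1 h2 h3, hv.weak_eq φ h1 h2 h3,
      sub_self]

/-! ### Modulus of continuity of the radial potential -/

section RadialPot

lemma radialPot_mono {n s t : ℝ} (hs : 0 < s) (hst : s ≤ t) : radialPot n s ≤ radialPot n t := by
  have hmono : MonotoneOn (radialPot n) (Ici s) := by
    refine monotoneOn_of_deriv_nonneg (convex_Ici s) (fun r hr => ?_) (fun r hr => ?_)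
      (fun r hr => ?_)
    · exact (hasDerivAt_radialPot n (hs.trans_le hr)).continuousAt.continuousWithinAt
    · rw [interior_Ici] at hr
      exact (hasDerivAt_radialPot n (hs.trans hr)).differentiableAt.differentiableWithinAt
    · rw [interior_Ici] at hr
      rw [(hasDerivAt_radialPot n (hs.trans hr)).deriv]
      exact Real.rpow_nonneg (hs.trans hr).le _
  exact hmono self_mem_Ici hst hst

/-- A Hölder-type modulus of continuity for the singular radial potential. -/
lemma radialPot_add_sub_le {n s ε : ℝ} (hn : 2 ≤ n) (hs : 0 < s) (hε : 0 ≤ ε) :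
    radialPot n (s + ε) - radialPot n s ≤ 4 * ε ^ (1 / 4 : ℝ) * s ^ (3 / 4 - n / 2) := by
  -- The power `1 / 4` is a compromise: with `s = |x - y|²` the singularity becomes `|x - y| ^ (-(d
  -- - 1 / 2))`, still integrable against a measure of growth `d`. Since `p < 0`, one has `r ^ p ≤ s
  -- ^ p` for `r ≥ s`, which gives the monotonicity below.
  set p : ℝ := 3 / 4 - n / 2 with hp
  have hanti : AntitoneOn (fun t => radialPot n t - 4 * s ^ p * t ^ (1 / 4 : ℝ)) (Ici s) := by
    have hd : ∀ r, 0 < r → HasDerivAt (fun t => radialPot n t - 4 * s ^ p * t ^ (1 / 4 : ℝ))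
        (r ^ (-(n / 2)) - 4 * s ^ p * (1 / 4 * r ^ (1 / 4 - 1 : ℝ))) r := fun r hr =>
      (hasDerivAt_radialPot n hr).sub
        ((Real.hasDerivAt_rpow_const (Or.inl hr.ne')).const_mul _)
    refine antitoneOn_of_deriv_nonpos (convex_Ici s) (fun r hr => ?_) (fun r hr => ?_)
      (fun r hr => ?_)
    · exact (hd r (hs.trans_le hr)).continuousAt.continuousWithinAt
    · rw [interior_Ici] at hr
      exact (hd r (hs.trans hr)).differentiableAt.differentiableWithinAt
    · rw [interior_Ici] at hr
      have hr0 : 0 < r := hs.trans hr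
      rw [(hd r hr0).deriv, sub_nonpos]
      have h1 : r ^ (-(n / 2)) = r ^ p * r ^ (1 / 4 - 1 : ℝ) := by
        rw [← Real.rpow_add hr0]; congr 1; rw [hp]; ring
      have h2 : r ^ p ≤ s ^ p :=
        Real.rpow_le_rpow_of_nonpos hs (le_of_lt hr) (by rw [hp]; linarith)
      have h3 : 0 ≤ r ^ (1 / 4 - 1 : ℝ) := Real.rpow_nonneg hr0.le _
      rw [h1]
      nlinarith [mul_le_mul_of_nonneg_right h2 h3]
  have h := hanti (self_mem_Ici) (show s + ε ∈ Ici s by simpa using hε) (by linarith)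
  simp only at h
  have h4 := Real.rpow_add_le_add_rpow hs.le hε (p := 1 / 4) (by norm_num) (by norm_num)
  have h5 : 0 ≤ s ^ p := Real.rpow_nonneg hs.le _
  nlinarith [mul_le_mul_of_nonneg_left h4 h5]

end RadialPot

/-! ### Integral bounds for upper regular measures -/

section Growth

variable {E : Type*} [NormedAddCommGroup E] [MeasurableSpace E]

lemma integrable_and_integral_le_of_lintegral_le {α : Type*} [MeasurableSpace α] {μ : Measure α}
    {f : α → ℝ} {M : ℝ} (hf : Measurable f) (hf0 : ∀ x, 0 ≤ f x) (hM : 0 ≤ M)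
    (h : ∫⁻ x, ENNReal.ofReal (f x) ∂μ ≤ ENNReal.ofReal M) :
    Integrable f μ ∧ ∫ x, f x ∂μ ≤ M := by
  refine ⟨⟨hf.aestronglyMeasurable, ?_⟩, ?_⟩
  · rw [hasFiniteIntegral_iff_ofReal (Eventually.of_forall hf0)]
    exact h.trans_lt ENNReal.ofReal_lt_top
  · rw [integral_eq_lintegral_of_nonneg_ae (Eventually.of_forall hf0) hf.aestronglyMeasurable]
    exact ENNReal.toReal_le_of_le_ofReal hM h

/-- Upper `d`-regularity of a measure with constant `C`. -/
def HasGrowth (μ : Measure E) (C : ℝ) (d : ℕ) : Prop :=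
  ∀ (z : E) (r : ℝ), 0 ≤ r → μ (closedBall z r) ≤ ENNReal.ofReal (C * r ^ d)

lemma HasGrowth.measure_singleton {μ : Measure E} {C : ℝ} {d : ℕ} (h : HasGrowth μ C d)
    (hd : 1 ≤ d) (z : E) : μ {z} = 0 := by
  have := h z 0 le_rfl
  rw [closedBall_zero, zero_pow (by omega)] at this
  simpa using this

variable [BorelSpace E]

/-- Riesz potentials of order above the growth exponent are uniformly bounded. -/
lemma HasGrowth.exists_integral_rpow_le {μ : Measure E} [IsFiniteMeasure μ] {C : ℝ} {d : ℕ}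
    (h : HasGrowth μ C d) (hC : 0 ≤ C) {a : ℝ} (ha : 0 < a) (had : a < d) :
    ∃ M : ℝ, 0 ≤ M ∧ ∀ z : E, Integrable (fun y => ‖z - y‖ ^ (-a)) μ ∧
      ∫ y, ‖z - y‖ ^ (-a) ∂μ ≤ M := by
  have hexp : -(d / a) < -1 := by
    rw [neg_lt_neg_iff, one_lt_div ha]; exact had
  set I : ℝ := ∫ t in Ioi (1 : ℝ), C * t ^ (-(d / a))
  have hI : 0 ≤ I := setIntegral_nonneg measurableSet_Ioi fun t ht =>
    mul_nonneg hC (Real.rpow_nonneg (zero_le_one.trans (le_of_lt ht)) _)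
  refine ⟨μ.real univ + I, by positivity, fun z => ?_⟩
  have hmeas : Measurable fun y : E => ‖z - y‖ ^ (-a) := by
    have : Measurable fun y : E => ‖z - y‖ := (continuous_const.sub continuous_id).norm.measurable
    exact this.pow_const _
  refine integrable_and_integral_le_of_lintegral_le hmeas
    (fun y => Real.rpow_nonneg (norm_nonneg _) _) (by positivity) ?_
  -- Layer cake, split at level `1`: lower levels cost at most the total mass, and a higher level
  -- `t` at most `C * t ^ (-(d / a))`, integrable since `a < d`.
  rw [lintegral_eq_lintegral_meas_le μ
    (Eventually.of_forall fun y => Real.rpow_nonneg (norm_nonneg _) _) hmeas.aemeasurable,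
    ← Ioc_union_Ioi_eq_Ioi (zero_le_one (α := ℝ)), ENNReal.ofReal_add (by positivity) hI]
  refine (lintegral_union_le _ _ _).trans (add_le_add ?_ ?_)
  · calc ∫⁻ t in Ioc (0 : ℝ) 1, μ {y | t ≤ ‖z - y‖ ^ (-a)}
        ≤ ∫⁻ t in Ioc (0 : ℝ) 1, μ univ := lintegral_mono fun t => measure_mono (subset_univ _)
      _ = ENNReal.ofReal (μ.real univ) := by simp [Measure.real]
  · have hint : IntegrableOn (fun t : ℝ => C * t ^ (-(d / a))) (Ioi 1) :=
      (integrableOn_Ioi_rpow_of_lt hexp one_pos).const_mul C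
    rw [ofReal_integral_eq_lintegral_ofReal hint
      ((ae_restrict_iff' measurableSet_Ioi).2 (Eventually.of_forall fun t ht =>
        mul_nonneg hC (Real.rpow_nonneg (zero_le_one.trans (le_of_lt ht)) _)))]
    refine setLIntegral_mono' measurableSet_Ioi fun t ht => ?_
    have ht0 : 0 < t := one_pos.trans ht
    refine (measure_mono (t := closedBall z (t ^ (-(1 / a)))) fun y hy => ?_).trans
      ((h z _ (Real.rpow_nonneg ht0.le _)).trans_eq ?_)
    · rw [mem_closedBall, dist_comm, dist_eq_norm]
      have hy' : t ≤ ‖z - y‖ ^ (-a) := hy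
      rcases (norm_nonneg (z - y)).eq_or_lt with h0 | h0
      · rw [← h0]; exact Real.rpow_nonneg ht0.le _
      · have := Real.rpow_le_rpow_of_nonpos ht0 hy' (z := -(1 / a)) (by
          rw [neg_nonpos]; positivity)
        rwa [← Real.rpow_mul h0.le, neg_mul_neg, mul_one_div_cancel ha.ne', Real.rpow_one] at this
    · rw [← Real.rpow_natCast, ← Real.rpow_mul ht0.le]
      congr 3
      field_simp

/-- A Poisson-kernel type bound for upper regular measures. -/
lemma HasGrowth.integral_div_max_pow_le {μ : Measure E} {C : ℝ} {d : ℕ}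
    (h : HasGrowth μ C d) (hC : 0 ≤ C) {ε : ℝ} (hε : 0 < ε) (z : E) :
    Integrable (fun y => ε / max ‖z - y‖ ε ^ (d + 1)) μ ∧
      ∫ y, ε / max ‖z - y‖ ε ^ (d + 1) ∂μ ≤ C * (d + 1) := by
  have hm : ∀ y : E, 0 < max ‖z - y‖ ε := fun y => lt_max_of_lt_right hε
  have hmeas : Measurable fun y : E => (ε / max ‖z - y‖ ε) ^ (d + 1) := by
    have : Measurable fun y : E => ‖z - y‖ := (continuous_const.sub continuous_id).norm.measurable
    exact (measurable_const.div (this.max measurable_const)).pow_const _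
  have hnn : ∀ y : E, 0 ≤ (ε / max ‖z - y‖ ε) ^ (d + 1) := fun y => by
    have := hm y; positivity
  set b : ℝ := -(d / (d + 1)) with hb
  have hb1 : -1 < b := by
    rw [hb, neg_lt_neg_iff, div_lt_one (by positivity)]; linarith
  have hval : ∫ t in (0 : ℝ)..1, C * ε ^ d * t ^ b = C * ε ^ d * (d + 1) := by
    rw [intervalIntegral.integral_const_mul, integral_rpow (Or.inl hb1)]
    have : b + 1 = 1 / (d + 1) := by rw [hb]; field_simp; ring
    rw [this, Real.one_rpow, Real.zero_rpow (by positivity)]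
    simp
  -- Layer cake again. The function takes values in `[0, 1]`, and its superlevel set at `t` lies in
  -- a ball of radius `ε * t ^ (-1 / (d + 1))`. This reduces the bound to `hval`; dividing by `ε ^
  -- d` at the end removes the dependence on `ε`.
  have key := integrable_and_integral_le_of_lintegral_le (μ := μ) (M := C * ε ^ d * (d + 1))
    hmeas hnn (by positivity) (by
    rw [lintegral_eq_lintegral_meas_le μ (Eventually.of_forall hnn) hmeas.aemeasurable,
      ← Ioc_union_Ioi_eq_Ioi (zero_le_one (α := ℝ))]
    refine (lintegral_union_le _ _ _).trans ?_
    have h2 : ∫⁻ t in Ioi (1 : ℝ), μ {y | t ≤ (ε / max ‖z - y‖ ε) ^ (d + 1)} = 0 := by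
      refine (setLIntegral_congr_fun measurableSet_Ioi (g := fun _ => 0) fun t ht => ?_).trans
        (by simp)
      have : {y : E | t ≤ (ε / max ‖z - y‖ ε) ^ (d + 1)} = ∅ := by
        refine eq_empty_of_forall_notMem fun y hy => ?_
        have h1 : (ε / max ‖z - y‖ ε) ^ (d + 1) ≤ 1 :=
          pow_le_one₀ (by have := hm y; positivity) ((div_le_one (hm y)).2 (le_max_right _ _))
        exact absurd (lt_of_lt_of_le ht (le_trans hy h1)) (lt_irrefl _)
      simp only [this, measure_empty]
    rw [h2, add_zero, ← hval, intervalIntegral.integral_of_le zero_le_one,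
      ofReal_integral_eq_lintegral_ofReal]
    · refine setLIntegral_mono' measurableSet_Ioc fun t ht => ?_
      have ht0 : 0 < t := ht.1
      refine (measure_mono (t := closedBall z (ε * t ^ (-(1 / ((d : ℝ) + 1))))) fun y hy => ?_).trans
        ((h z _ (mul_nonneg hε.le (Real.rpow_nonneg ht0.le _))).trans_eq ?_)
      · rw [mem_closedBall, dist_comm, dist_eq_norm]
        refine (le_max_left _ ε).trans ?_
        have hy' : t ≤ (ε / max ‖z - y‖ ε) ^ (d + 1) := hy
        have h3 := Real.rpow_le_rpow_of_nonpos ht0 hy' (z := -(1 / ((d : ℝ) + 1))) (by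
          rw [neg_nonpos]; positivity)
        have h4 : 0 < ε / max ‖z - y‖ ε := div_pos hε (hm y)
        rw [← Real.rpow_natCast, ← Real.rpow_mul h4.le] at h3
        have h5 : ((d + 1 : ℕ) : ℝ) * -(1 / ((d : ℝ) + 1)) = -1 := by push_cast; field_simp
        rw [h5, Real.rpow_neg_one, inv_div, div_le_iff₀ hε] at h3
        linarith
      · rw [mul_pow, ← Real.rpow_natCast (t ^ _), ← Real.rpow_mul ht0.le, ← mul_assoc]
        congr 3
        rw [hb]; field_simp
    · exact ((intervalIntegral.intervalIntegrable_rpow' hb1).const_mul _).1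
    · exact (ae_restrict_iff' measurableSet_Ioc).2 (Eventually.of_forall fun t ht =>
        mul_nonneg (by positivity) (Real.rpow_nonneg (le_of_lt ht.1) _)))
  have heq : (fun y : E => ε / max ‖z - y‖ ε ^ (d + 1)) =
      fun y => (ε ^ d)⁻¹ * (ε / max ‖z - y‖ ε) ^ (d + 1) := by
    funext y
    have := (hm y).ne'
    rw [div_pow, pow_succ ε d]
    field_simp
  rw [heq]
  refine ⟨key.1.const_mul _, ?_⟩
  rw [integral_const_mul, inv_mul_le_iff₀ (by positivity)]
  linarith [key.2]

end Growth

/-! ### The regularized Newtonian kernel as an approximate identity -/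

section Bubble

variable {E : Type*} [NormedAddCommGroup E]

/-- The profile of the Laplacian of the regularized radial potential. -/
noncomputable def bubble (n : ℝ) (z : E) : ℝ := 2 * n * (1 + ‖z‖ ^ 2) ^ (-(n / 2) - 1)

lemma bubble_pos {n : ℝ} (hn : 0 < n) (z : E) : 0 < bubble n z := by
  have : 0 < 1 + ‖z‖ ^ 2 := by positivity
  exact mul_pos (by positivity) (Real.rpow_pos_of_pos this _)

lemma continuous_bubble (n : ℝ) : Continuous (bubble n : E → ℝ) := by
  refine continuous_const.mul (Continuous.rpow_const (by fun_prop) fun z => Or.inl ?_)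
  positivity

end Bubble

section ApproximateIdentity

variable {E : Type*} [NormedAddCommGroup E] [InnerProductSpace ℝ E] [FiniteDimensional ℝ E]
  [MeasurableSpace E] [BorelSpace E]

lemma integrable_bubble :
    Integrable (bubble (Module.finrank ℝ E) : E → ℝ) := by
  have h := integrable_rpow_neg_one_add_norm_sq (E := E) (μ := volume)
    (r := (Module.finrank ℝ E : ℝ) + 2) (by linarith)
  have h2 : (bubble (Module.finrank ℝ E) : E → ℝ) = fun z =>
      2 * (Module.finrank ℝ E : ℝ) *
        (1 + ‖z‖ ^ 2) ^ (-((Module.finrank ℝ E : ℝ) + 2) / 2) := by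
    funext z
    unfold bubble
    congr 2
    ring
  rw [h2]
  exact h.const_mul _

lemma integral_bubble_pos [Nontrivial E] :
    0 < ∫ z : E, bubble (Module.finrank ℝ E) z := by
  have hn : (0 : ℝ) < Module.finrank ℝ E := by exact_mod_cast Module.finrank_pos
  exact integral_pos_of_integrable_nonneg_nonzero (x := (0 : E)) (continuous_bubble _)
    integrable_bubble (fun z => (bubble_pos hn z).le) (bubble_pos hn 0).ne'

/-- Green's identity moves the Laplacian onto the kernel, where the discriminant is `δ²`; the
substitution `x = y + δ z` absorbs every power of `δ`. -/
lemma integral_radialPot_mul_laplacian {φ : E → ℝ} (hφ : ContDiff ℝ 2 φ)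
    (hc : HasCompactSupport φ) (y : E) {δ : ℝ} (hδ : 0 < δ) :
    ∫ x, radialPot (Module.finrank ℝ E) (‖x - y‖ ^ 2 + δ ^ 2) * (Δ φ) x =
      ∫ z, bubble (Module.finrank ℝ E) z * φ (y + δ • z) := by
  have hq : ∀ x : E, 0 < 1 * ‖x‖ ^ 2 - 2 * inner ℝ x y + (‖y‖ ^ 2 + δ ^ 2) := fun x => by
    rw [← norm_sub_sq_add]; positivity
  simp_rw [norm_sub_sq_add _ y]
  rw [integral_mul_laplacian_eq hφ hc fun x _ => contDiffAt_radialPot_quadratic (hq x)]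
  simp_rw [laplacian_radialPot_quadratic (hq _), ← norm_sub_sq_add]
  set n : ℝ := ((Module.finrank ℝ E : ℕ) : ℝ) with hn
  set g : E → ℝ := fun x => 2 * n * (1 * (‖y‖ ^ 2 + δ ^ 2) - ‖y‖ ^ 2) *
    (‖x - y‖ ^ 2 + δ ^ 2) ^ (-(n / 2) - 1) * φ x with hg
  have h1 : ∫ x, g x = ∫ x, g (y + x) := (integral_add_left_eq_self g y).symm
  have h2 := Measure.integral_comp_smul (volume : Measure E) (fun x => g (y + x)) δ
  have hpos : 0 < δ ^ Module.finrank ℝ E := by positivity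
  rw [abs_of_pos (inv_pos.2 hpos), smul_eq_mul] at h2
  have h3 : ∫ x, g x = δ ^ Module.finrank ℝ E * ∫ z, g (y + δ • z) := by
    rw [h2, h1, mul_inv_cancel_left₀ hpos.ne']
  refine h3.trans ?_
  rw [← integral_const_mul]
  refine integral_congr_ae (Eventually.of_forall fun z => ?_)
  simp only [hg, bubble]
  have h4 : ‖y + δ • z - y‖ ^ 2 + δ ^ 2 = δ ^ 2 * (1 + ‖z‖ ^ 2) := by
    rw [add_sub_cancel_left, norm_smul, mul_pow, Real.norm_eq_abs, sq_abs]; ring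
  have h5 : (δ ^ 2 * (1 + ‖z‖ ^ 2)) ^ (-(n / 2) - 1) =
      (δ ^ Module.finrank ℝ E)⁻¹ * (δ ^ 2)⁻¹ * (1 + ‖z‖ ^ 2) ^ (-(n / 2) - 1) := by
    rw [Real.mul_rpow (by positivity) (by positivity)]
    congr 1
    rw [← Real.rpow_natCast δ 2, ← Real.rpow_mul hδ.le, ← Real.rpow_natCast δ (Module.finrank ℝ E),
      ← hn, ← Real.rpow_neg hδ.le, ← Real.rpow_neg hδ.le, ← Real.rpow_add hδ]
    congr 1
    push_cast
    ring
  rw [h4, h5]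
  field_simp
  ring

lemma integral_bubble_mul_le {φ : E → ℝ} {K : ℝ} (hK : ∀ x, |φ x| ≤ K) (y : E) (δ : ℝ) :
    ‖∫ z, bubble (Module.finrank ℝ E) z * φ (y + δ • z)‖ ≤
      ∫ z : E, bubble (Module.finrank ℝ E) z * K := by
  refine norm_integral_le_of_norm_le (integrable_bubble.mul_const K)
    (Eventually.of_forall fun z => ?_)
  have h0 : 0 ≤ bubble (Module.finrank ℝ E) z := by
    unfold bubble; positivity
  rw [norm_mul, Real.norm_of_nonneg h0]
  exact mul_le_mul_of_nonneg_left (hK _) h0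

lemma tendsto_integral_bubble_mul {φ : E → ℝ} (hφ : Continuous φ) {K : ℝ} (hK : ∀ x, |φ x| ≤ K)
    (y : E) :
    Tendsto (fun δ : ℝ => ∫ z, bubble (Module.finrank ℝ E) z * φ (y + δ • z)) (𝓝[>] 0)
      (𝓝 ((∫ z : E, bubble (Module.finrank ℝ E) z) * φ y)) := by
  rw [← integral_mul_const]
  refine tendsto_integral_filter_of_dominated_convergence
    (fun z => bubble (Module.finrank ℝ E) z * K) ?_ ?_ (integrable_bubble.mul_const K) ?_
  · exact Eventually.of_forall fun δ => ((continuous_bubble _).mul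
      (hφ.comp (by fun_prop))).aestronglyMeasurable
  · refine Eventually.of_forall fun δ => Eventually.of_forall fun z => ?_
    have h0 : 0 ≤ bubble (Module.finrank ℝ E) z := by
      unfold bubble; positivity
    rw [norm_mul, Real.norm_of_nonneg h0]
    exact mul_le_mul_of_nonneg_left (hK _) h0
  · refine Eventually.of_forall fun z => ?_
    have h1 : Continuous fun δ : ℝ => bubble (Module.finrank ℝ E) z * φ (y + δ • z) :=
      continuous_const.mul (hφ.comp (by fun_prop))
    have h2 : Tendsto (fun δ : ℝ => bubble (Module.finrank ℝ E) z * φ (y + δ • z)) (𝓝[>] 0)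
        (𝓝 (bubble (Module.finrank ℝ E) z * φ (y + (0 : ℝ) • z))) :=
      (h1.tendsto 0).mono_left nhdsWithin_le_nhds
    simpa using h2

end ApproximateIdentity

/-! ### The Green function of the unit ball -/

section GreenKernel

variable {E : Type*} [NormedAddCommGroup E] [InnerProductSpace ℝ E]

/-- Up to a constant, the Green function of the unit ball, regularized at scale `√ε`. -/
noncomputable def greenKernel (n ε : ℝ) (x y : E) : ℝ :=
  radialPot n (‖x - y‖ ^ 2 + ε) - radialPot n (‖y‖ ^ 2 * ‖x‖ ^ 2 - 2 * inner ℝ x y + 1)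

/-- By Cauchy-Schwarz the expression is at least `(1 - ‖x‖ ‖y‖)²`. -/
lemma reflected_pos {x y : E} (hx : ‖x‖ ≤ 1) (hy : ‖y‖ < 1) :
    0 < ‖y‖ ^ 2 * ‖x‖ ^ 2 - 2 * inner ℝ x y + 1 := by
  have h1 := real_inner_le_norm x y
  have h2 : ‖x‖ * ‖y‖ < 1 := by nlinarith [norm_nonneg x, norm_nonneg y]
  nlinarith [mul_pos (sub_pos.2 h2) (sub_pos.2 h2)]

lemma greenKernel_zero_of_norm_eq_one {n : ℝ} {x : E} (hx : ‖x‖ = 1) (y : E) :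
    greenKernel n 0 x y = 0 := by
  rw [greenKernel, norm_sub_sq_real, hx, sub_eq_zero]
  congr 1
  ring

lemma continuousOn_greenKernel {n ε ρ : ℝ} (hε : 0 < ε) (hρ : ρ < 1) :
    ContinuousOn (Function.uncurry (greenKernel (E := E) n ε))
      (closedBall 0 1 ×ˢ closedBall 0 ρ) := by
  rintro ⟨x, y⟩ ⟨hx, hy⟩
  have hx' : ‖x‖ ≤ 1 := by simpa using hx
  have hy' : ‖y‖ < 1 := lt_of_le_of_lt (by simpa using hy) hρ
  refine ContinuousAt.continuousWithinAt (ContinuousAt.sub ?_ ?_)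
  · refine ContinuousAt.comp (f := fun p : E × E => ‖p.1 - p.2‖ ^ 2 + ε) (x := (x, y))
      (hasDerivAt_radialPot n (by positivity)).continuousAt ?_
    fun_prop
  · refine ContinuousAt.comp (f := fun p : E × E => ‖p.2‖ ^ 2 * ‖p.1‖ ^ 2 - 2 * inner ℝ p.1 p.2 + 1)
      (x := (x, y)) (hasDerivAt_radialPot n (reflected_pos hx' hy')).continuousAt ?_
    fun_prop

lemma measurable_greenKernel [MeasurableSpace E] [BorelSpace E] (n ε : ℝ) (x : E) :
    Measurable (greenKernel n ε x) := by
  have h1 : Continuous fun y : E => ‖x - y‖ ^ 2 + ε := by fun_prop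
  have h2 : Continuous fun y : E => ‖y‖ ^ 2 * ‖x‖ ^ 2 - 2 * inner ℝ x y + 1 := by fun_prop
  exact ((measurable_radialPot n).comp h1.measurable).sub
    ((measurable_radialPot n).comp h2.measurable)

/-- The reflected terms do not involve `ε` and cancel, leaving the modulus of continuity of
`radialPot` at `s = ‖x - y‖²`. -/
lemma abs_greenKernel_sub_le {n ε : ℝ} (hn : 2 ≤ n) (hε : 0 ≤ ε) {x y : E} (hxy : y ≠ x) :
    |greenKernel n ε x y - greenKernel n 0 x y| ≤
      4 * ε ^ (1 / 4 : ℝ) * ‖x - y‖ ^ (-(n - 3 / 2)) := by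
  have hpos : 0 < ‖x - y‖ := norm_pos_iff.2 (sub_ne_zero.2 hxy.symm)
  have hs : 0 < ‖x - y‖ ^ 2 := by positivity
  have h1 : greenKernel n ε x y - greenKernel n 0 x y =
      radialPot n (‖x - y‖ ^ 2 + ε) - radialPot n (‖x - y‖ ^ 2) := by
    simp [greenKernel]
  rw [h1, abs_of_nonneg (sub_nonneg.2 (radialPot_mono hs (by linarith)))]
  refine (radialPot_add_sub_le hn hs hε).trans_eq ?_
  rw [← Real.rpow_natCast, ← Real.rpow_mul hpos.le]
  congr 2
  push_cast
  ring

end GreenKernel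

/-- A kernel which is continuous on a compact product is bounded on it. -/
lemma exists_bound_of_continuousOn_prod {X Y : Type*} [TopologicalSpace X]
    [TopologicalSpace Y] {H : X → Y → ℝ} {K : Set X} {L : Set Y} (hK : IsCompact K)
    (hL : IsCompact L) (hH : ContinuousOn (Function.uncurry H) (K ×ˢ L)) :
    ∃ B : ℝ, ∀ x ∈ K, ∀ y ∈ L, ‖H x y‖ ≤ B := by
  obtain ⟨B, hB⟩ := (hK.prod hL).exists_bound_of_continuousOn hH
  exact ⟨B, fun x hx y hy => hB (x, y) ⟨hx, hy⟩⟩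

lemma continuousOn_integral_of_continuousOn_prod {X Y : Type*} [TopologicalSpace X]
    [FirstCountableTopology X] [TopologicalSpace Y] [MeasurableSpace Y] {μ : Measure Y}
    [IsFiniteMeasure μ] {H : X → Y → ℝ} {K : Set X} {L : Set Y} (hK : IsCompact K) (hL : IsCompact L)
    (hμ : ∀ᵐ y ∂μ, y ∈ L) (hH : ContinuousOn (Function.uncurry H) (K ×ˢ L))
    (hm : ∀ x, Measurable (H x)) :
    ContinuousOn (fun x => ∫ y, H x y ∂μ) K := by
  obtain ⟨B, hB⟩ := exists_bound_of_continuousOn_prod hK hL hH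
  refine continuousOn_of_dominated (bound := fun _ => B)
    (fun x _ => (hm x).aestronglyMeasurable) (fun x hx => hμ.mono fun y hy => hB x hx y hy)
    (integrable_const B) (hμ.mono fun y hy => ?_)
  exact hH.comp (f := fun x : X => (x, y)) (by fun_prop) fun x hx => ⟨hx, hy⟩

lemma ae_abs_greenKernel_sub_le {E : Type*} [NormedAddCommGroup E] [InnerProductSpace ℝ E]
    [MeasurableSpace E] {μ : Measure E} {C : ℝ} {d : ℕ} (hd : 1 ≤ d) (hg : HasGrowth μ C d) {ε : ℝ} (hε : 0 ≤ ε) (x : E) :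
    ∀ᵐ y ∂μ, |greenKernel (d + 1) ε x y - greenKernel (d + 1) 0 x y| ≤
      4 * ε ^ (1 / 4 : ℝ) * ‖x - y‖ ^ (-((d : ℝ) - 1 / 2)) := by
  have h1 : ∀ᵐ y ∂μ, y ≠ x := measure_eq_zero_iff_ae_notMem.1 (hg.measure_singleton hd x)
  have h2 : (2 : ℝ) ≤ d + 1 := by
    have : (1 : ℝ) ≤ d := by exact_mod_cast hd
    linarith
  filter_upwards [h1] with y hy
  refine (abs_greenKernel_sub_le h2 hε hy).trans_eq ?_
  congr 2
  ring

lemma exists_rpow_bound {E : Type*} [NormedAddCommGroup E] [MeasurableSpace E] [BorelSpace E]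
    {μ : Measure E} [IsFiniteMeasure μ] {C : ℝ} {d : ℕ} (hd : 1 ≤ d) (hg : HasGrowth μ C d) (hC : 0 ≤ C) :
    ∃ M : ℝ, 0 ≤ M ∧ ∀ z : E, Integrable (fun y => ‖z - y‖ ^ (-((d : ℝ) - 1 / 2))) μ ∧
      ∫ y, ‖z - y‖ ^ (-((d : ℝ) - 1 / 2)) ∂μ ≤ M := by
  have : (1 : ℝ) ≤ d := by exact_mod_cast hd
  exact hg.exists_integral_rpow_le hC (by linarith) (by linarith)

/-! ### The Green potential and its weak equation -/

section Potential

variable {E : Type*} [NormedAddCommGroup E] [InnerProductSpace ℝ E] [FiniteDimensional ℝ E]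
  [MeasurableSpace E] [BorelSpace E]

lemma setIntegral_integral_mul_swap {μ : Measure E} [IsFiniteMeasure μ]
    {H : E → E → ℝ} {ψ : E → ℝ} {B K L : Set E} (hK : IsCompact K) (hL : IsCompact L)
    (hBK : B ⊆ K) (hμ : ∀ᵐ y ∂μ, y ∈ L) (hH : ContinuousOn (Function.uncurry H) (K ×ˢ L))
    (hψ : Continuous ψ) :
    ∫ x in B, (∫ y, H x y ∂μ) * ψ x = ∫ y, (∫ x in B, H x y * ψ x) ∂μ := by
  simp_rw [← integral_mul_const]
  refine integral_integral_swap ?_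
  have hres : μ.restrict L = μ := Measure.restrict_eq_self_of_ae_mem hμ
  have h1 : IntegrableOn (Function.uncurry fun x y => H x y * ψ x) (K ×ˢ L)
      ((volume : Measure E).prod μ) :=
    ContinuousOn.integrableOn_compact (hK.prod hL) (hH.mul (hψ.comp continuous_fst).continuousOn)
  have h2 := h1.mono_set (prod_mono hBK (subset_refl L))
  rwa [IntegrableOn, ← Measure.prod_restrict, hres] at h2

/-- Up to a constant, the Green potential in the unit ball of a measure, regularized at scale
`√ε`. -/
noncomputable def greenPotential (n : ℝ) (μ : Measure E) (ε : ℝ) (x : E) : ℝ :=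
  ∫ y, greenKernel n ε x y ∂μ

variable {μ : Measure E} [IsFiniteMeasure μ] {C ρ : ℝ} {d : ℕ}

lemma integrable_greenKernel_of_pos {n ε : ℝ} (hε : 0 < ε) (hρ : ρ < 1)
    (hμ : ∀ᵐ y ∂μ, y ∈ closedBall 0 ρ) {x : E} (hx : x ∈ closedBall (0 : E) 1) :
    Integrable (greenKernel n ε x) μ := by
  obtain ⟨B, hB⟩ := exists_bound_of_continuousOn_prod (isCompact_closedBall (0 : E) 1)
    (isCompact_closedBall (0 : E) ρ) (continuousOn_greenKernel (n := n) hε hρ)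
  exact (integrable_const B).mono' (measurable_greenKernel n ε x).aestronglyMeasurable
    (hμ.mono fun y hy => hB x hx y hy)

lemma continuousOn_greenPotential_of_pos {n ε : ℝ} (hε : 0 < ε) (hρ : ρ < 1)
    (hμ : ∀ᵐ y ∂μ, y ∈ closedBall 0 ρ) :
    ContinuousOn (greenPotential n μ ε) (closedBall 0 1) :=
  continuousOn_integral_of_continuousOn_prod (isCompact_closedBall (0 : E) 1)
    (isCompact_closedBall (0 : E) ρ) hμ (continuousOn_greenKernel hε hρ)
    (measurable_greenKernel n ε)

/-- Comparison with the kernel at `ε = 1`, which is bounded on the support of `μ`; the difference is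
dominated by a Riesz kernel. -/
lemma integrable_greenKernel_zero (hd : 1 ≤ d) (hg : HasGrowth μ C d) (hC : 0 ≤ C) (hρ : ρ < 1)
    (hμ : ∀ᵐ y ∂μ, y ∈ closedBall 0 ρ) {x : E} (hx : x ∈ closedBall (0 : E) 1) :
    Integrable (greenKernel (d + 1) 0 x) μ := by
  obtain ⟨M, -, hM⟩ := exists_rpow_bound hd hg hC
  have h1 : Integrable (greenKernel (d + 1) 1 x) μ := integrable_greenKernel_of_pos one_pos hρ hμ hx
  have h2 : Integrable (fun y => greenKernel (d + 1) 1 x y - greenKernel (d + 1) 0 x y) μ :=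
    ((hM x).1.const_mul (4 * 1 ^ (1 / 4 : ℝ))).mono'
      ((measurable_greenKernel _ _ x).sub (measurable_greenKernel _ _ x)).aestronglyMeasurable
      (ae_abs_greenKernel_sub_le hd hg zero_le_one x)
  exact (h1.sub h2).congr (Eventually.of_forall fun y => by simp)

/-- The uniform rate that transfers both continuity and the weak equation from the regularized
potentials to the singular one. -/
lemma exists_abs_greenPotential_sub_le (hd : 1 ≤ d) (hg : HasGrowth μ C d) (hC : 0 ≤ C)
    (hρ : ρ < 1) (hμ : ∀ᵐ y ∂μ, y ∈ closedBall 0 ρ) :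
    ∃ M : ℝ, ∀ ε : ℝ, 0 < ε → ∀ x ∈ closedBall (0 : E) 1,
      |greenPotential (d + 1) μ ε x - greenPotential (d + 1) μ 0 x| ≤ M * ε ^ (1 / 4 : ℝ) := by
  obtain ⟨M, hM0, hM⟩ := exists_rpow_bound hd hg hC
  refine ⟨4 * M, fun ε hε x hx => ?_⟩
  unfold greenPotential
  rw [← integral_sub (integrable_greenKernel_of_pos hε hρ hμ hx)
    (integrable_greenKernel_zero hd hg hC hρ hμ hx)]
  have hae : ∀ᵐ y ∂μ, ‖greenKernel (d + 1) ε x y - greenKernel (d + 1) 0 x y‖ ≤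
      4 * ε ^ (1 / 4 : ℝ) * ‖x - y‖ ^ (-((d : ℝ) - 1 / 2)) :=
    ae_abs_greenKernel_sub_le hd hg hε.le x
  rw [← Real.norm_eq_abs]
  refine (norm_integral_le_of_norm_le ((hM x).1.const_mul (4 * ε ^ (1 / 4 : ℝ))) hae).trans ?_
  rw [integral_const_mul]
  have : 0 ≤ 4 * ε ^ (1 / 4 : ℝ) := by positivity
  nlinarith [mul_le_mul_of_nonneg_left (hM x).2 this]

lemma tendsto_rpow_quarter (M : ℝ) :
    Tendsto (fun δ : ℝ => M * (δ ^ 2) ^ (1 / 4 : ℝ)) (𝓝[>] 0) (𝓝 0) := by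
  have h : Continuous fun δ : ℝ => M * (δ ^ 2) ^ (1 / 4 : ℝ) :=
    continuous_const.mul (Continuous.rpow_const (by fun_prop) fun _ => Or.inr (by norm_num))
  have h2 : Tendsto (fun δ : ℝ => M * (δ ^ 2) ^ (1 / 4 : ℝ)) (𝓝[>] 0)
      (𝓝 (M * ((0 : ℝ) ^ 2) ^ (1 / 4 : ℝ))) := (h.tendsto 0).mono_left nhdsWithin_le_nhds
  simpa using h2

lemma continuousOn_greenPotential_zero (hd : 1 ≤ d) (hg : HasGrowth μ C d) (hC : 0 ≤ C)
    (hρ : ρ < 1) (hμ : ∀ᵐ y ∂μ, y ∈ closedBall 0 ρ) :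
    ContinuousOn (greenPotential (d + 1) μ 0) (closedBall 0 1) := by
  obtain ⟨M, hM⟩ := exists_abs_greenPotential_sub_le hd hg hC hρ hμ
  have hu : TendstoUniformlyOn (fun δ : ℝ => greenPotential (d + 1) μ (δ ^ 2))
      (greenPotential (d + 1) μ 0) (𝓝[>] 0) (closedBall 0 1) := by
    rw [Metric.tendstoUniformlyOn_iff]
    intro κ hκ
    filter_upwards [(tendsto_rpow_quarter M).eventually (gt_mem_nhds hκ), self_mem_nhdsWithin]
      with δ hδ hδ0 x hx
    have hδ0' : 0 < δ := hδ0
    rw [dist_comm, Real.dist_eq]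
    exact (hM (δ ^ 2) (by positivity) x hx).trans_lt hδ
  refine hu.continuousOn (Eventually.frequently ?_)
  filter_upwards [self_mem_nhdsWithin] with δ hδ0
  have hδ0' : 0 < δ := hδ0
  exact continuousOn_greenPotential_of_pos (by positivity) hρ hμ

/-- The reflected part has discriminant `‖y‖² * 1 - ‖y‖² = 0`, so it is harmonic on the support of
`φ` and drops out. -/
lemma setIntegral_greenKernel_mul_laplacian (hn : Module.finrank ℝ E = d + 1) {φ : E → ℝ}
    (hφ : ContDiff ℝ 2 φ) (hc : HasCompactSupport φ) (hφs : tsupport φ ⊆ ball 0 1) {δ : ℝ}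
    (hδ : 0 < δ) {y : E} (hy : ‖y‖ < 1) :
    ∫ x in ball 0 1, greenKernel (d + 1) (δ ^ 2) x y * (Δ φ) x =
      ∫ z, bubble (Module.finrank ℝ E) z * φ (y + δ • z) := by
  have hn' : ((Module.finrank ℝ E : ℕ) : ℝ) = d + 1 := by rw [hn]; push_cast; rfl
  have hΔ : Continuous (Δ φ) := continuous_iff_continuousAt.2 fun x =>
    continuousAt_laplacian hφ.contDiffAt
  have hΔc : HasCompactSupport (Δ φ) := HasCompactSupport.intro hc fun x hx =>
    laplacian_eq_zero_of_notMem_tsupport hx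
  have hq : ∀ x ∈ tsupport φ, 0 < ‖y‖ ^ 2 * ‖x‖ ^ 2 - 2 * inner ℝ x y + 1 := fun x hx =>
    reflected_pos (le_of_lt (by simpa using hφs hx)) hy
  rw [setIntegral_eq_integral_of_forall_compl_eq_zero fun x hx => by
    rw [laplacian_eq_zero_of_notMem_tsupport fun h => hx (hφs h), mul_zero]]
  simp_rw [greenKernel, sub_mul]
  rw [integral_sub]
  · rw [← hn', integral_radialPot_mul_laplacian hφ hc y hδ,
      integral_mul_laplacian_eq hφ hc fun x hx => contDiffAt_radialPot_quadratic (hq x hx),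
      sub_eq_self]
    refine integral_eq_zero_of_ae (Eventually.of_forall fun x => ?_)
    by_cases hx : x ∈ tsupport φ
    · simp only [Pi.zero_apply]
      rw [laplacian_radialPot_quadratic (hq x hx)]
      simp
    · simp [image_eq_zero_of_notMem_tsupport hx]
  · refine Continuous.integrable_of_hasCompactSupport (Continuous.mul ?_ hΔ) hΔc.mul_left
    refine continuous_iff_continuousAt.2 fun x => ?_
    exact ContinuousAt.comp (f := fun x : E => ‖x - y‖ ^ 2 + δ ^ 2)
      (hasDerivAt_radialPot _ (by positivity)).continuousAt (by fun_prop)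
  · refine Continuous.integrable_of_hasCompactSupport ?_ hΔc.mul_left
    exact continuous_mul_of_tsupport (isClosed_tsupport φ) support_laplacian_subset hΔ
      fun x hx => (contDiffAt_radialPot_quadratic (k := 1) (hq x hx)).continuousAt

/-- The Green potential solves the Poisson equation in the sense of distributions. -/
lemma setIntegral_greenPotential_mul_laplacian (hn : Module.finrank ℝ E = d + 1) (hd : 1 ≤ d)
    (hg : HasGrowth μ C d) (hC : 0 ≤ C) (hρ : ρ < 1) (hμ : ∀ᵐ y ∂μ, y ∈ closedBall 0 ρ)
    {φ : E → ℝ} (hφ : ContDiff ℝ 2 φ) (hc : HasCompactSupport φ) (hφs : tsupport φ ⊆ ball 0 1) :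
    ∫ x in ball 0 1, greenPotential (d + 1) μ 0 x * (Δ φ) x =
      (∫ z : E, bubble (Module.finrank ℝ E) z) * ∫ y, φ y ∂μ := by
  have hΔ : Continuous (Δ φ) := continuous_iff_continuousAt.2 fun x =>
    continuousAt_laplacian hφ.contDiffAt
  obtain ⟨K, hK⟩ := hc.exists_bound_of_continuous hφ.continuous
  obtain ⟨M, hM⟩ := exists_abs_greenPotential_sub_le hd hg hC hρ hμ
  have hint : ∀ {w : E → ℝ}, ContinuousOn w (closedBall 0 1) →
      IntegrableOn (fun x => w x * (Δ φ) x) (ball 0 1) := fun hw =>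
    ((hw.mul hΔ.continuousOn).integrableOn_compact (isCompact_closedBall 0 1)).mono_set
      ball_subset_closedBall
  -- The weak identity at scale `δ`, by Fubini. Its right side converges by dominated convergence
  -- (`hlim1`), its left side by the uniform rate (`hlim2`).
  have hval : ∀ δ : ℝ, 0 < δ →
      ∫ x in ball 0 1, greenPotential (d + 1) μ (δ ^ 2) x * (Δ φ) x =
        ∫ y, (∫ z, bubble (Module.finrank ℝ E) z * φ (y + δ • z)) ∂μ := fun δ hδ => by
    unfold greenPotential
    rw [setIntegral_integral_mul_swap (isCompact_closedBall (0 : E) 1)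
      (isCompact_closedBall (0 : E) ρ) ball_subset_closedBall hμ
      (continuousOn_greenKernel (by positivity) hρ) hΔ]
    refine integral_congr_ae (hμ.mono fun y hy => ?_)
    exact setIntegral_greenKernel_mul_laplacian hn hφ hc hφs hδ
      (lt_of_le_of_lt (by simpa using hy) hρ)
  have hlim1 : Tendsto (fun δ : ℝ =>
      ∫ y, (∫ z, bubble (Module.finrank ℝ E) z * φ (y + δ • z)) ∂μ) (𝓝[>] 0)
      (𝓝 (∫ y, (∫ z : E, bubble (Module.finrank ℝ E) z) * φ y ∂μ)) := by
    refine tendsto_integral_filter_of_dominated_convergence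
      (fun _ => ∫ z : E, bubble (Module.finrank ℝ E) z * K) ?_ ?_ (integrable_const _) ?_
    · refine Eventually.of_forall fun δ => Continuous.aestronglyMeasurable ?_
      refine continuous_of_dominated (bound := fun z => bubble (Module.finrank ℝ E) z * K)
        (fun y => ((continuous_bubble _).mul
          (hφ.continuous.comp (by fun_prop))).aestronglyMeasurable) (fun y => ?_)
        (integrable_bubble.mul_const K) (Eventually.of_forall fun z =>
          continuous_const.mul (hφ.continuous.comp (by fun_prop)))
      refine Eventually.of_forall fun z => ?_
      have h0 : 0 ≤ bubble (Module.finrank ℝ E) z := by unfold bubble; positivity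
      rw [norm_mul, Real.norm_of_nonneg h0]
      exact mul_le_mul_of_nonneg_left (hK _) h0
    · exact Eventually.of_forall fun δ => Eventually.of_forall fun y =>
        integral_bubble_mul_le hK y δ
    · exact Eventually.of_forall fun y => tendsto_integral_bubble_mul hφ.continuous hK y
  rw [integral_const_mul] at hlim1
  have hlim2 : Tendsto (fun δ : ℝ =>
      ∫ x in ball 0 1, greenPotential (d + 1) μ (δ ^ 2) x * (Δ φ) x) (𝓝[>] 0)
      (𝓝 (∫ x in ball 0 1, greenPotential (d + 1) μ 0 x * (Δ φ) x)) := by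
    have hΔi : IntegrableOn (fun x => |(Δ φ) x|) (ball (0 : E) 1) :=
      (hΔ.abs.continuousOn.integrableOn_compact (isCompact_closedBall 0 1)).mono_set
        ball_subset_closedBall
    rw [tendsto_iff_norm_sub_tendsto_zero]
    refine squeeze_zero' (Eventually.of_forall fun _ => norm_nonneg _) ?_
      (tendsto_rpow_quarter (M * ∫ x in ball (0 : E) 1, |(Δ φ) x|))
    filter_upwards [self_mem_nhdsWithin] with δ hδ0
    have hδ0' : 0 < δ := hδ0
    have hδ2 : 0 < δ ^ 2 := by positivity
    rw [← integral_sub (hint (continuousOn_greenPotential_of_pos hδ2 hρ hμ))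
      (hint (continuousOn_greenPotential_zero hd hg hC hρ hμ))]
    refine (norm_integral_le_of_norm_le (hΔi.const_mul (M * (δ ^ 2) ^ (1 / 4 : ℝ))) ?_).trans_eq ?_
    · refine (ae_restrict_iff' measurableSet_ball).2 (Eventually.of_forall fun x hx => ?_)
      rw [← sub_mul, norm_mul, Real.norm_eq_abs, Real.norm_eq_abs]
      exact mul_le_mul_of_nonneg_right (hM _ hδ2 x (ball_subset_closedBall hx)) (abs_nonneg _)
    · rw [integral_const_mul]; ring
  refine tendsto_nhds_unique hlim2 (hlim1.congr' ?_)
  filter_upwards [self_mem_nhdsWithin] with δ hδ0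
  exact (hval δ hδ0).symm

end Potential

/-! ### Differentiating the potential off the support -/

section Gradient

variable {E : Type*} [NormedAddCommGroup E] [InnerProductSpace ℝ E]

/-- The derivative of `greenKernel n 0 · y`. -/
noncomputable def greenKernelFDeriv (n : ℝ) (x y : E) : E →L[ℝ] ℝ :=
  (‖x - y‖ ^ 2) ^ (-(n / 2)) • innerSL ℝ ((2 : ℝ) • (x - y)) -
    (‖y‖ ^ 2 * ‖x‖ ^ 2 - 2 * inner ℝ x y + 1) ^ (-(n / 2)) •
      innerSL ℝ ((2 : ℝ) • (‖y‖ ^ 2 • x - y))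

lemma hasFDerivAt_greenKernel {n : ℝ} {x y : E} (hx : ‖x‖ ≤ 1) (hy : ‖y‖ < 1) (hxy : x ≠ y) :
    HasFDerivAt (fun x => greenKernel n 0 x y) (greenKernelFDeriv n x y) x := by
  have h1 : 0 < 1 * ‖x‖ ^ 2 - 2 * inner ℝ x y + (‖y‖ ^ 2 + 0) := by
    rw [← norm_sub_sq_add, add_zero]
    have := norm_pos_iff.2 (sub_ne_zero.2 hxy)
    positivity
  have h2 := (hasFDerivAt_radialPot_quadratic (n := n) h1).sub
    (hasFDerivAt_radialPot_quadratic (n := n) (reflected_pos hx hy))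
  simp_rw [← norm_sub_sq_add] at h2
  simp only [add_zero, one_smul] at h2
  simp only [greenKernel, greenKernelFDeriv, add_zero]
  exact h2

lemma reflected_ge {x y : E} {ρ : ℝ} (hρ : ρ < 1) (hx : ‖x‖ ≤ 1) (hy : ‖y‖ ≤ ρ) :
    (1 - ρ) ^ 2 ≤ ‖y‖ ^ 2 * ‖x‖ ^ 2 - 2 * inner ℝ x y + 1 := by
  have h1 := real_inner_le_norm x y
  have h2 : ‖x‖ * ‖y‖ ≤ ρ := by nlinarith [norm_nonneg x, norm_nonneg y]
  nlinarith [mul_nonneg (sub_nonneg.2 h2) (sub_nonneg.2 hρ.le)]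

lemma norm_rpow_smul_innerSL_le {n s a : ℝ} (hn : 0 ≤ n) (ha : 0 < a) (has : a ≤ s) {w : E}
    (hw : ‖w‖ ≤ 2) : ‖s ^ (-(n / 2)) • innerSL ℝ ((2 : ℝ) • w)‖ ≤ 4 * a ^ (-(n / 2)) := by
  have h1 : s ^ (-(n / 2)) ≤ a ^ (-(n / 2)) :=
    Real.rpow_le_rpow_of_nonpos ha has (by linarith)
  have h2 : 0 ≤ s ^ (-(n / 2)) := Real.rpow_nonneg (ha.le.trans has) _
  rw [norm_smul, innerSL_apply_norm, norm_smul, Real.norm_of_nonneg h2, Real.norm_of_nonneg zero_le_two]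
  nlinarith [norm_nonneg w]

lemma norm_reflected_grad_le {x y : E} (hx : ‖x‖ ≤ 1) (hy : ‖y‖ ≤ 1) :
    ‖‖y‖ ^ 2 • x - y‖ ≤ 2 := by
  refine (norm_sub_le _ _).trans ?_
  rw [norm_smul, norm_pow, norm_norm]
  have : ‖y‖ ^ 2 ≤ 1 := pow_le_one₀ (norm_nonneg _) hy
  nlinarith [norm_nonneg x, norm_nonneg y, sq_nonneg ‖y‖]

variable [FiniteDimensional ℝ E] [MeasurableSpace E] [BorelSpace E]

lemma aestronglyMeasurable_rpow_smul_innerSL {μ : Measure E} {n : ℝ} {q : E → ℝ} {w : E → E}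
    (hq : Continuous q) (hw : Continuous w) :
    AEStronglyMeasurable (fun y => q y ^ (-(n / 2)) • innerSL ℝ (w y)) μ := by
  have h1 : Measurable fun y => q y ^ (-(n / 2)) := hq.measurable.pow_const _
  exact h1.aestronglyMeasurable.smul ((innerSL ℝ).continuous.comp hw).aestronglyMeasurable

/-- Away from the support of the measure the Green potential is differentiable, and its derivative
is that of the Newtonian part up to a bounded error. -/
lemma exists_hasFDerivAt_greenPotential {μ : Measure E} [IsFiniteMeasure μ] {n ρ η : ℝ}
    (hn : 0 ≤ n) (hρ : ρ < 1) (hμ : ∀ᵐ y ∂μ, y ∈ closedBall 0 ρ) {x₀ : E} (hx₀ : ‖x₀‖ < 1)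
    (hη : 0 < η) (hfar : ∀ᵐ y ∂μ, η ≤ ‖x₀ - y‖)
    (hint : Integrable (greenKernel n 0 x₀) μ) (v : E) :
    Integrable (fun y => (‖x₀ - y‖ ^ 2) ^ (-(n / 2)) * inner ℝ (x₀ - y) v) μ ∧
    ∃ L : E →L[ℝ] ℝ, HasFDerivAt (greenPotential n μ 0) L x₀ ∧
      L v ≤ 2 * ∫ y, (‖x₀ - y‖ ^ 2) ^ (-(n / 2)) * inner ℝ (x₀ - y) v ∂μ +
        4 * ((1 - ρ) ^ 2) ^ (-(n / 2)) * ‖v‖ * μ.real univ := by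
  set N : E → E →L[ℝ] ℝ := fun y => (‖x₀ - y‖ ^ 2) ^ (-(n / 2)) • innerSL ℝ ((2 : ℝ) • (x₀ - y))
    with hN
  set P : E → E →L[ℝ] ℝ := fun y => (‖y‖ ^ 2 * ‖x₀‖ ^ 2 - 2 * inner ℝ x₀ y + 1) ^ (-(n / 2)) •
      innerSL ℝ ((2 : ℝ) • (‖y‖ ^ 2 • x₀ - y)) with hP
  have hNm : AEStronglyMeasurable N μ :=
    aestronglyMeasurable_rpow_smul_innerSL (by fun_prop) (by fun_prop)
  have hPm : AEStronglyMeasurable P μ :=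
    aestronglyMeasurable_rpow_smul_innerSL (by fun_prop) (by fun_prop)
  have hμ1 : ∀ᵐ y ∂μ, ‖y‖ ≤ ρ := hμ.mono fun y hy => by simpa using hy
  have hρ2 : 0 < (1 - ρ) ^ 2 := by have := sub_pos.2 hρ; positivity
  have hNb : ∀ᵐ y ∂μ, ‖N y‖ ≤ 4 * (η ^ 2) ^ (-(n / 2)) := by
    filter_upwards [hμ1, hfar] with y hy hfy
    refine norm_rpow_smul_innerSL_le hn (by positivity) (by gcongr) ?_
    linarith [norm_sub_le x₀ y]
  have hPb : ∀ᵐ y ∂μ, ‖P y‖ ≤ 4 * ((1 - ρ) ^ 2) ^ (-(n / 2)) := by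
    filter_upwards [hμ1] with y hy
    exact norm_rpow_smul_innerSL_le hn hρ2 (reflected_ge hρ hx₀.le hy)
      (norm_reflected_grad_le hx₀.le (hy.trans hρ.le))
  have hNi : Integrable N μ := (integrable_const _).mono' hNm hNb
  have hPi : Integrable P μ := (integrable_const _).mono' hPm hPb
  have hder : HasFDerivAt (greenPotential n μ 0) (∫ y, greenKernelFDeriv n x₀ y ∂μ) x₀ := by
    -- On this ball points stay in the unit ball and at distance at least `η / 2` from almost every
    -- `y`, so the derivatives of the kernel have a constant bound.
    set r : ℝ := min (η / 2) (1 - ‖x₀‖) with hr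
    have hr0 : 0 < r := lt_min (by positivity) (by linarith)
    have hball : ∀ x ∈ ball x₀ r, ‖x‖ ≤ 1 ∧ ∀ y, η ≤ ‖x₀ - y‖ → η / 2 ≤ ‖x - y‖ := fun x hx => by
      have h1 : ‖x - x₀‖ < r := by simpa [dist_eq_norm] using hx
      have h2 := min_le_left (η / 2) (1 - ‖x₀‖)
      have h3 := min_le_right (η / 2) (1 - ‖x₀‖)
      constructor
      · have := norm_add_le (x - x₀) x₀
        rw [sub_add_cancel] at this
        linarith
      · intro y hy
        have := norm_sub_le_norm_sub_add_norm_sub x₀ x y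
        rw [norm_sub_rev x₀ x] at this
        linarith
    refine hasFDerivAt_integral_of_dominated_of_fderiv_le (ball_mem_nhds x₀ hr0)
      (F' := greenKernelFDeriv n)
      (bound := fun _ => 4 * ((η / 2) ^ 2) ^ (-(n / 2)) + 4 * ((1 - ρ) ^ 2) ^ (-(n / 2)))
      (Eventually.of_forall fun x => (measurable_greenKernel n 0 x).aestronglyMeasurable)
      hint (hNm.sub hPm) ?_ (integrable_const _) ?_
    · filter_upwards [hμ1, hfar] with y hy hfy x hx
      obtain ⟨hx1, hxy⟩ := hball x hx
      refine (norm_sub_le _ _).trans (add_le_add ?_ ?_)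
      · refine norm_rpow_smul_innerSL_le hn (by positivity) (by gcongr; exact hxy y hfy) ?_
        linarith [norm_sub_le x y]
      · exact norm_rpow_smul_innerSL_le hn hρ2 (reflected_ge hρ hx1 hy)
          (norm_reflected_grad_le hx1 (hy.trans hρ.le))
    · filter_upwards [hμ1, hfar] with y hy hfy x hx
      obtain ⟨hx1, hxy⟩ := hball x hx
      refine hasFDerivAt_greenKernel hx1 (hy.trans_lt hρ) fun h => ?_
      have := hxy y hfy
      rw [h, sub_self, norm_zero] at this
      linarith
  have hNv : ∀ y, N y v = 2 * ((‖x₀ - y‖ ^ 2) ^ (-(n / 2)) * inner ℝ (x₀ - y) v) := fun y => by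
    simp only [hN, _root_.smul_apply, innerSL_apply_apply, inner_smul_left, smul_eq_mul]
    simp
    ring
  have hNvi : Integrable (fun y => N y v) μ := hNi.apply_continuousLinearMap v
  have hPvi : Integrable (fun y => P y v) μ := hPi.apply_continuousLinearMap v
  refine ⟨?_, _, hder, ?_⟩
  · refine (hNvi.const_mul (1 / 2)).congr (Eventually.of_forall fun y => ?_)
    simp only [hNv]
    ring
  · have happ : (∫ y, greenKernelFDeriv n x₀ y ∂μ) v = ∫ y, (N y v - P y v) ∂μ :=
      ContinuousLinearMap.integral_apply (hNi.sub hPi) v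
    rw [happ, integral_sub hNvi hPvi, ← integral_const_mul]
    simp_rw [hNv]
    have hPle : ‖∫ y, P y v ∂μ‖ ≤ ∫ _, 4 * ((1 - ρ) ^ 2) ^ (-(n / 2)) * ‖v‖ ∂μ :=
      norm_integral_le_of_norm_le (integrable_const _) (hPb.mono fun y hy =>
        ((P y).le_opNorm v).trans (mul_le_mul_of_nonneg_right hy (norm_nonneg v)))
    rw [integral_const, smul_eq_mul] at hPle
    have := neg_abs_le (∫ y, P y v ∂μ)
    rw [Real.norm_eq_abs] at hPle
    linarith

end Gradient

/-! ### Divergence of the logarithmic integral -/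

section RadialDivergence

/-- Up to sign the integrand is the derivative of `log (-log t)`, which tends to infinity as `t`
decreases to `0`. -/
lemma not_integrableOn_inv_mul_log {r : ℝ} (hr : 0 < r) :
    ¬ IntegrableOn (fun t : ℝ => t⁻¹ / |Real.log t|) (Ioo 0 r) := by
  have hlog : Tendsto (fun t : ℝ => -Real.log t) (𝓝[>] 0) atTop :=
    tendsto_neg_atBot_atTop.comp Real.tendsto_log_nhdsGT_zero
  have hsmall : ∀ᶠ t : ℝ in 𝓝[>] 0, 0 < t ∧ Real.log t < 0 := by
    filter_upwards [self_mem_nhdsWithin, hlog.eventually_gt_atTop 0] with t h1 h2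
    exact ⟨h1, by linarith⟩
  have hder : ∀ t : ℝ, 0 < t → Real.log t < 0 →
      HasDerivAt (fun t => Real.log (-Real.log t)) (-t⁻¹ / -Real.log t) t := fun t h1 h2 =>
    ((Real.hasDerivAt_log h1.ne').neg).log (neg_pos.2 h2).ne'
  refine not_integrableOn_of_tendsto_norm_atTop_of_deriv_isBigO_filter
    (f := fun t => Real.log (-Real.log t)) (𝓝[>] 0) (Ioo_mem_nhdsGT hr) ?_ ?_ ?_
  · filter_upwards [hsmall] with t ht using (hder t ht.1 ht.2).differentiableAt
  · exact tendsto_norm_atTop_atTop.comp (Real.tendsto_log_atTop.comp hlog)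
  · refine Asymptotics.IsBigO.of_bound 1 ?_
    filter_upwards [hsmall] with t ht
    rw [(hder t ht.1 ht.2).deriv, one_mul, norm_div, norm_div, norm_neg, norm_neg, norm_abs_eq_norm]

/-- The function `|z|^(-d) / |log |z||` is not integrable at the origin of `ℝ^d`. -/
lemma lintegral_norm_pow_div_log_eq_top {d : ℕ} (hd : 1 ≤ d) {r : ℝ} (hr : 0 < r) :
    ∫⁻ z in ball (0 : EuclideanSpace ℝ (Fin d)) r,
      ENNReal.ofReal ((‖z‖ ^ d)⁻¹ / |Real.log ‖z‖|) = ⊤ := by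
  by_contra hne
  have : Nonempty (Fin d) := ⟨⟨0, hd⟩⟩
  have hm : Measurable fun z : EuclideanSpace ℝ (Fin d) => (‖z‖ ^ d)⁻¹ / |Real.log ‖z‖| :=
    ((measurable_norm.pow_const d).inv).div
      (continuous_abs.measurable.comp (Real.measurable_log.comp measurable_norm))
  have hi : IntegrableOn (fun z : EuclideanSpace ℝ (Fin d) =>
      (fun t : ℝ => (t ^ d)⁻¹ / |Real.log t|) ‖z‖) (ball 0 r) := by
    refine ⟨hm.aestronglyMeasurable, ?_⟩
    rw [hasFiniteIntegral_iff_ofReal (Eventually.of_forall fun z => by positivity)]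
    exact lt_top_iff_ne_top.2 hne
  -- Polar coordinates: the Jacobian `t ^ (d - 1)` turns the integrand into `t⁻¹ / |log t|`.
  have hi' := (integrableOn_fun_norm_addHaar (volume : Measure (EuclideanSpace ℝ (Fin d)))
    (f := fun t : ℝ => (t ^ d)⁻¹ / |Real.log t|) (r := r)).1 hi
  refine not_integrableOn_inv_mul_log hr (hi'.congr_fun (fun t ht => ?_) measurableSet_Ioo)
  have ht0 : 0 < t := ht.1
  obtain ⟨k, rfl⟩ : ∃ k, d = k + 1 := ⟨d - 1, by omega⟩
  simp only [finrank_euclideanSpace, Fintype.card_fin, Nat.add_sub_cancel, smul_eq_mul]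
  rw [pow_succ, mul_inv, mul_div_assoc, mul_inv_cancel_left₀ (pow_pos ht0 k).ne']

end RadialDivergence

/-! ### Horizontal and vertical coordinates -/

section Coordinates

variable {d : ℕ}

/-- The point with given horizontal part and height. -/
noncomputable def ofHorizVert (z : EuclideanSpace ℝ (Fin d)) (t : ℝ) :
    EuclideanSpace ℝ (Fin (d + 1)) :=
  WithLp.toLp 2 (Fin.snoc (α := fun _ => ℝ) z t)

@[simp] lemma horiz_ofHorizVert (z : EuclideanSpace ℝ (Fin d)) (t : ℝ) :
    horiz (ofHorizVert z t) = z := by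
  ext i; simp [horiz, ofHorizVert]

@[simp] lemma vert_ofHorizVert (z : EuclideanSpace ℝ (Fin d)) (t : ℝ) :
    vert (ofHorizVert z t) = t := by
  simp [vert, ofHorizVert]

lemma ofHorizVert_horiz_vert (x : EuclideanSpace ℝ (Fin (d + 1))) :
    ofHorizVert (horiz x) (vert x) = x := by
  ext i
  refine Fin.lastCases ?_ (fun j => ?_) i <;> simp [ofHorizVert, horiz, vert]

lemma norm_sq_eq_horiz_add_vert (x : EuclideanSpace ℝ (Fin (d + 1))) :
    ‖x‖ ^ 2 = ‖horiz x‖ ^ 2 + vert x ^ 2 := by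
  rw [EuclideanSpace.norm_sq_eq, EuclideanSpace.norm_sq_eq, Fin.sum_univ_castSucc]
  simp [horiz, vert]

lemma horiz_sub (x y : EuclideanSpace ℝ (Fin (d + 1))) : horiz (x - y) = horiz x - horiz y := by
  ext i; simp [horiz]

lemma vert_sub (x y : EuclideanSpace ℝ (Fin (d + 1))) : vert (x - y) = vert x - vert y := by
  simp [vert]

lemma norm_horiz_le (x : EuclideanSpace ℝ (Fin (d + 1))) : ‖horiz x‖ ≤ ‖x‖ := by
  have := norm_sq_eq_horiz_add_vert x
  exact abs_le_of_sq_le_sq' (by nlinarith [sq_nonneg (vert x)]) (norm_nonneg _) |>.2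

lemma abs_vert_le (x : EuclideanSpace ℝ (Fin (d + 1))) : |vert x| ≤ ‖x‖ := by
  have := norm_sq_eq_horiz_add_vert x
  exact abs_le_of_sq_le_sq (by nlinarith [sq_nonneg ‖horiz x‖]) (norm_nonneg _)

lemma norm_le_horiz_add_vert (x : EuclideanSpace ℝ (Fin (d + 1))) : ‖x‖ ≤ ‖horiz x‖ + |vert x| := by
  have := norm_sq_eq_horiz_add_vert x
  refine abs_le_of_sq_le_sq' ?_ (by positivity) |>.2
  nlinarith [sq_abs (vert x), mul_nonneg (norm_nonneg (horiz x)) (abs_nonneg (vert x))]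

lemma lipschitzWith_horiz : LipschitzWith 1 (horiz (d := d)) :=
  LipschitzWith.mk_one fun x y => by
    rw [dist_eq_norm, dist_eq_norm, ← horiz_sub]
    exact norm_horiz_le _

lemma inner_lastVec (x : EuclideanSpace ℝ (Fin (d + 1))) : inner ℝ x (lastVec d) = vert x := by
  simp [lastVec, vert, EuclideanSpace.inner_single_right]

lemma horiz_smul_lastVec (ε : ℝ) : horiz (ε • lastVec d) = 0 := by
  ext i; simp [horiz, lastVec]

lemma vert_smul_lastVec (ε : ℝ) : vert (ε • lastVec d) = ε := by
  simp [vert, lastVec]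

lemma norm_lastVec : ‖lastVec d‖ = 1 := by simp [lastVec]

end Coordinates

/-! ### Growth of the surface measure of a `C^1` hypersurface -/

section HausdorffMeasure

open scoped NNReal ENNReal

lemma euclideanHausdorffMeasure_image_le {X Y : Type*} [MetricSpace X] [MetricSpace Y]
    [MeasurableSpace X] [BorelSpace X] [MeasurableSpace Y] [BorelSpace Y] {K : ℝ≥0} {f : X → Y}
    {s : Set X} (hf : LipschitzOnWith K f s) (d : ℕ) :
    (μHE[d] : Measure Y) (f '' s) ≤ (K : ℝ≥0∞) ^ d * (μHE[d] : Measure X) s := by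
  simp_rw [Measure.euclideanHausdorffMeasure_def, Measure.smul_apply]
  have h := hf.hausdorffMeasure_image_le (d := d) (by positivity)
  rw [ENNReal.rpow_natCast] at h
  rw [mul_smul_comm]
  exact smul_le_smul_of_nonneg_left h zero_le

variable {d : ℕ}

/-- Near `x₀` the surface lies in the image of a Lipschitz graph map `G`. The projection back to the
parameters is 1-Lipschitz, so the part in a ball of radius `r` comes from parameters in a ball of
the same radius, and `G` enlarges the measure by at most `(1 + K) ^ d`. -/
lemma exists_local_growth {Γ : Set (EuclideanSpace ℝ (Fin (d + 1)))}
    (hΓ : IsClosedC1Hypersurface Γ) {x₀ : EuclideanSpace ℝ (Fin (d + 1))} (hx₀ : x₀ ∈ Γ) :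
    ∃ s : ℝ, 0 < s ∧ ∃ C : ℝ, 0 ≤ C ∧ ∀ (z : EuclideanSpace ℝ (Fin (d + 1))) (r : ℝ), 0 ≤ r →
      μHE[d] ((Γ ∩ ball x₀ s) ∩ closedBall z r) ≤ ENNReal.ofReal (C * r ^ d) := by
  obtain ⟨r₀, hr₀, R, ψ, hψ, hgraph⟩ := hΓ.2 x₀ hx₀
  set c := horiz (R x₀) with hc
  obtain ⟨K, t, ht, hK⟩ :=
    (hψ.contDiffAt (isOpen_ball.mem_nhds (mem_ball_self hr₀))).exists_lipschitzOnWith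
  obtain ⟨s', hs', hst⟩ := Metric.mem_nhds_iff.1 ht
  set s := min s' r₀
  have hs : 0 < s := lt_min hs' hr₀
  have hlip : LipschitzOnWith K ψ (ball c s) :=
    hK.mono ((ball_subset_ball (min_le_left _ _)).trans hst)
  set G : EuclideanSpace ℝ (Fin d) → EuclideanSpace ℝ (Fin (d + 1)) := fun z =>
    R.symm (ofHorizVert z (ψ z)) with hG
  have hGlip : LipschitzOnWith (1 + K) G (ball c s) := LipschitzOnWith.of_dist_le_mul
    fun z hz w hw => by
      have h1 := hlip.dist_le_mul z hz w hw
      rw [hG, R.symm.dist_map, dist_eq_norm]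
      refine (norm_le_horiz_add_vert _).trans ?_
      rw [horiz_sub, vert_sub]
      simp only [horiz_ofHorizVert, vert_ofHorizVert]
      rw [Real.dist_eq] at h1
      rw [← dist_eq_norm]
      push_cast
      linarith
  have hsub : ∀ (z : EuclideanSpace ℝ (Fin (d + 1))) (r : ℝ),
      (Γ ∩ ball x₀ s) ∩ closedBall z r ⊆ G '' (ball c s ∩ closedBall (horiz (R z)) r) := by
    rintro z r y ⟨⟨hyΓ, hys⟩, hyr⟩
    have hy : y ∈ Γ ∩ ball x₀ r₀ := ⟨hyΓ, ball_subset_ball (min_le_right _ _) hys⟩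
    rw [hgraph] at hy
    have hdist : ∀ w, dist (horiz (R y)) (horiz (R w)) ≤ dist y w := fun w => by
      have := lipschitzWith_horiz.dist_le_mul (R y) (R w)
      rwa [R.dist_map, NNReal.coe_one, one_mul] at this
    refine ⟨horiz (R y), ⟨(hdist x₀).trans_lt hys, (hdist z).trans hyr⟩, ?_⟩
    simp only [hG]
    rw [← hy.2, ofHorizVert_horiz_vert, R.symm_apply_apply]
  set V := volume (ball (0 : EuclideanSpace ℝ (Fin d)) 1) with hV
  have hVtop : V ≠ ⊤ := measure_ball_lt_top.ne
  refine ⟨s, hs, (1 + K : ℝ) ^ d * V.toReal, by positivity, fun z r hr => ?_⟩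
  calc μHE[d] ((Γ ∩ ball x₀ s) ∩ closedBall z r)
      ≤ μHE[d] (G '' (ball c s ∩ closedBall (horiz (R z)) r)) := measure_mono (hsub z r)
    _ ≤ ((1 + K : ℝ≥0) : ℝ≥0∞) ^ d * μHE[d] (ball c s ∩ closedBall (horiz (R z)) r) :=
        euclideanHausdorffMeasure_image_le (hGlip.mono inter_subset_left) d
    _ ≤ ((1 + K : ℝ≥0) : ℝ≥0∞) ^ d * volume (closedBall (horiz (R z)) r) := by
        rw [EuclideanSpace.euclideanHausdorffMeasure_eq_volume]
        gcongr
        exact inter_subset_right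
    _ = ENNReal.ofReal ((1 + K : ℝ) ^ d * V.toReal * r ^ d) := by
        rw [Measure.addHaar_closedBall _ _ hr, ENNReal.ofReal_mul (by positivity),
          ENNReal.ofReal_mul (by positivity), ENNReal.ofReal_toReal hVtop, finrank_euclideanSpace,
          Fintype.card_fin, ENNReal.ofReal_pow (by positivity), mul_assoc,
          mul_comm V]
        congr 2
        rw [← ENNReal.ofReal_coe_nnreal]
        push_cast
        exact (ENNReal.ofReal_pow (by positivity) d).symm

/-- A closed `C^1` hypersurface is upper regular. -/
lemma IsClosedC1Hypersurface.exists_hasGrowth {Γ : Set (EuclideanSpace ℝ (Fin (d + 1)))}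
    (hΓ : IsClosedC1Hypersurface Γ) :
    ∃ C : ℝ, 0 ≤ C ∧ HasGrowth (μHE[d].restrict Γ) C d := by
  have key : ∃ C : ℝ, 0 ≤ C ∧ ∀ (z : EuclideanSpace ℝ (Fin (d + 1))) (r : ℝ), 0 ≤ r →
      μHE[d] (Γ ∩ closedBall z r) ≤ ENNReal.ofReal (C * r ^ d) := by
    -- The growth bound passes to subsets and finite unions, so compactness globalizes the local
    -- bounds.
    refine hΓ.1.induction_on (p := fun S => ∃ C : ℝ, 0 ≤ C ∧
      ∀ (z : EuclideanSpace ℝ (Fin (d + 1))) (r : ℝ), 0 ≤ r →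
        μHE[d] (S ∩ closedBall z r) ≤ ENNReal.ofReal (C * r ^ d)) ?_ ?_ ?_ ?_
    · exact ⟨0, le_rfl, fun z r _ => by simp⟩
    · rintro S T hST ⟨C, hC, h⟩
      exact ⟨C, hC, fun z r hr => (measure_mono (inter_subset_inter_left _ hST)).trans (h z r hr)⟩
    · rintro S T ⟨C, hC, h⟩ ⟨C', hC', h'⟩
      refine ⟨C + C', by positivity, fun z r hr => ?_⟩
      rw [union_inter_distrib_right, add_mul, ENNReal.ofReal_add (by positivity) (by positivity)]
      exact (measure_union_le _ _).trans (add_le_add (h z r hr) (h' z r hr))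
    · intro x₀ hx₀
      obtain ⟨s, hs, C, hC, h⟩ := exists_local_growth hΓ hx₀
      exact ⟨Γ ∩ ball x₀ s, inter_mem_nhdsWithin _ (ball_mem_nhds x₀ hs), C, hC, h⟩
  obtain ⟨C, hC, h⟩ := key
  refine ⟨C, hC, fun z r hr => ?_⟩
  rw [Measure.restrict_apply measurableSet_closedBall, inter_comm]
  exact h z r hr

end HausdorffMeasure

/-! ### The logarithmic graph and the diverging derivative -/

section LogCusp

open scoped NNReal ENNReal

variable {d : ℕ}

lemma two_le_abs_log {r : ℝ} (hr : 0 < r) (hr8 : r ≤ 1 / 8) : 2 ≤ |Real.log r| := by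
  have h1 : Real.log r ≤ Real.log (1 / 8) := Real.log_le_log hr hr8
  have h2 : Real.log (1 / 8) = -(3 * Real.log 2) := by
    rw [one_div, Real.log_inv, show (8 : ℝ) = 2 ^ 3 by norm_num, Real.log_pow]; norm_num
  have h3 := Real.log_two_gt_d9
  rw [h2] at h1
  rw [abs_of_neg (by linarith)]
  linarith

lemma div_abs_log_le_half {r : ℝ} (hr : 0 ≤ r) (hr8 : r ≤ 1 / 8) : r / |Real.log r| ≤ r / 2 := by
  -- At `r = 0` the defaults `log 0 = 0` and `0 / 0 = 0` give the value `0` that the graph function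
  -- is meant to have there.
  rcases hr.eq_or_lt with rfl | h
  · simp
  · exact div_le_div_of_nonneg_left h.le two_pos (two_le_abs_log h hr8)

lemma sq_rpow_neg_half {s : ℝ} (hs : 0 ≤ s) (d : ℕ) :
    (s ^ 2) ^ (-(((d : ℝ) + 1) / 2)) = (s ^ (d + 1))⁻¹ := by
  rw [Real.rpow_neg (by positivity), ← Real.rpow_natCast s 2, ← Real.rpow_mul hs,
    ← Real.rpow_natCast s (d + 1)]
  congr 2
  push_cast
  ring

/-- The vertical derivative of the Newtonian kernel, up to a constant. -/
noncomputable def vertKernel (ε : ℝ) (y : EuclideanSpace ℝ (Fin (d + 1))) : ℝ :=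
  (‖ε • lastVec d - y‖ ^ (d + 1))⁻¹ * (ε - vert y)

lemma rpow_mul_inner_eq_vertKernel (ε : ℝ) (y : EuclideanSpace ℝ (Fin (d + 1))) :
    (‖ε • lastVec d - y‖ ^ 2) ^ (-(((d : ℝ) + 1) / 2)) * inner ℝ (ε • lastVec d - y) (lastVec d) =
      vertKernel ε y := by
  rw [sq_rpow_neg_half (norm_nonneg _), inner_lastVec, vert_sub, vert_smul_lastVec, vertKernel]

variable {Γ : Set (EuclideanSpace ℝ (Fin (d + 1)))}

/-- Near the origin, `Γ` is the graph of `|x'| / |log |x'||`. -/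
def IsLogCusp (Γ : Set (EuclideanSpace ℝ (Fin (d + 1)))) : Prop :=
  Γ ∩ ball 0 (1 / 4) = {x | x ∈ ball 0 (1 / 4) ∧ vert x = ‖horiz x‖ / |Real.log ‖horiz x‖|}

lemma IsLogCusp.vert_eq (h : IsLogCusp Γ) {y : EuclideanSpace ℝ (Fin (d + 1))} (hy : y ∈ Γ)
    (hy8 : y ∈ ball (0 : EuclideanSpace ℝ (Fin (d + 1))) (1 / 8)) :
    vert y = ‖horiz y‖ / |Real.log ‖horiz y‖| ∧ ‖horiz y‖ ≤ 1 / 8 ∧ 0 ≤ vert y ∧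
      vert y ≤ ‖horiz y‖ / 2 := by
  have h1 : y ∈ Γ ∩ ball 0 (1 / 4) := ⟨hy, ball_subset_ball (by norm_num) hy8⟩
  rw [h] at h1
  have h2 : ‖horiz y‖ ≤ 1 / 8 := (norm_horiz_le y).trans (le_of_lt (by simpa using hy8))
  refine ⟨h1.2, h2, ?_, ?_⟩
  · rw [h1.2]; positivity
  · rw [h1.2]; exact div_abs_log_le_half (norm_nonneg _) h2

/-- Write `ε = (ε - y_n) + y_n`. The first term is at most the distance, and `y_n ≤ |y'| / 2` is at
most half of it. Hence the axis point stays off `Γ` at distance comparable to `ε`. -/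
lemma IsLogCusp.le_two_mul_norm_sub (h : IsLogCusp Γ) {y : EuclideanSpace ℝ (Fin (d + 1))}
    (hy : y ∈ Γ) (hy8 : y ∈ ball (0 : EuclideanSpace ℝ (Fin (d + 1))) (1 / 8)) (ε : ℝ) :
    ε ≤ 2 * ‖ε • lastVec d - y‖ := by
  obtain ⟨-, -, -, h2⟩ := h.vert_eq hy hy8
  have h3 := abs_vert_le (ε • lastVec d - y)
  have h4 := norm_horiz_le (ε • lastVec d - y)
  rw [vert_sub, vert_smul_lastVec] at h3
  rw [horiz_sub, horiz_smul_lastVec, zero_sub, norm_neg] at h4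
  have := le_abs_self (ε - vert y)
  linarith [norm_nonneg (horiz y)]

lemma norm_smul_lastVec {ε : ℝ} (hε : 0 ≤ ε) : ‖ε • lastVec d‖ = ε := by
  rw [norm_smul, norm_lastVec, mul_one, Real.norm_of_nonneg hε]

lemma sixteenth_le_norm_sub {ε : ℝ} (hε : 0 ≤ ε) (hε16 : ε ≤ 1 / 16)
    {y : EuclideanSpace ℝ (Fin (d + 1))}
    (hy8 : y ∉ ball (0 : EuclideanSpace ℝ (Fin (d + 1))) (1 / 8)) :
    1 / 16 ≤ ‖ε • lastVec d - y‖ := by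
  have h1 : 1 / 8 ≤ ‖y‖ := by simpa using hy8
  have h2 := norm_sub_norm_le y (ε • lastVec d)
  rw [norm_sub_rev, norm_smul_lastVec hε] at h2
  linarith

lemma IsLogCusp.half_le_norm_sub (h : IsLogCusp Γ) {y : EuclideanSpace ℝ (Fin (d + 1))}
    (hy : y ∈ Γ) {ε : ℝ} (hε : 0 ≤ ε) (hε16 : ε ≤ 1 / 16) : ε / 2 ≤ ‖ε • lastVec d - y‖ := by
  by_cases hy8 : y ∈ ball (0 : EuclideanSpace ℝ (Fin (d + 1))) (1 / 8)
  · linarith [h.le_two_mul_norm_sub hy hy8 ε]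
  · linarith [sixteenth_le_norm_sub hε hε16 hy8]

/-- Since `y_n ≥ 0` it can be dropped from the numerator. The Poisson-type majorant has bounded
integral, and majorant minus `vertKernel` is nonnegative, as Fatou's lemma requires. -/
lemma IsLogCusp.vertKernel_le_near (h : IsLogCusp Γ) {y : EuclideanSpace ℝ (Fin (d + 1))}
    (hy : y ∈ Γ) (hy8 : y ∈ ball (0 : EuclideanSpace ℝ (Fin (d + 1))) (1 / 8)) {ε : ℝ}
    (hε : 0 < ε) :
    vertKernel ε y ≤ 2 ^ (d + 1) * (ε / max ‖ε • lastVec d - y‖ ε ^ (d + 1)) := by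
  have h1 := h.le_two_mul_norm_sub hy hy8 ε
  obtain ⟨-, -, hv, -⟩ := h.vert_eq hy hy8
  set D := ‖ε • lastVec d - y‖
  have hD : 0 < D := by linarith
  have hmax : max D ε ≤ 2 * D := max_le (by linarith) h1
  have hm0 : 0 < max D ε := lt_max_of_lt_left hD
  have h2 : max D ε ^ (d + 1) ≤ 2 ^ (d + 1) * D ^ (d + 1) := by
    rw [← mul_pow]; exact pow_le_pow_left₀ hm0.le hmax _
  calc vertKernel ε y = (ε - vert y) / D ^ (d + 1) := by rw [vertKernel, inv_mul_eq_div]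
    _ ≤ ε / D ^ (d + 1) := by gcongr; linarith
    _ ≤ 2 ^ (d + 1) * (ε / max D ε ^ (d + 1)) := by
      rw [mul_div_assoc', div_le_div_iff₀ (by positivity) (by positivity)]
      nlinarith [mul_le_mul_of_nonneg_left h2 hε.le]

lemma vertKernel_le_far {ε : ℝ} (hε : 0 ≤ ε) (hε16 : ε ≤ 1 / 16)
    {y : EuclideanSpace ℝ (Fin (d + 1))} (hy1 : ‖y‖ ≤ 1)
    (hy8 : y ∉ ball (0 : EuclideanSpace ℝ (Fin (d + 1))) (1 / 8)) :
    vertKernel ε y ≤ 2 * 16 ^ (d + 1) := by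
  have h1 := sixteenth_le_norm_sub hε hε16 hy8
  have h2 := (neg_abs_le (vert y))
  have h3 := abs_vert_le y
  have h4 : (‖ε • lastVec d - y‖ ^ (d + 1))⁻¹ ≤ 16 ^ (d + 1) := by
    have : (1 / 16 : ℝ) ^ (d + 1) ≤ ‖ε • lastVec d - y‖ ^ (d + 1) :=
      pow_le_pow_left₀ (by norm_num) h1 _
    calc (‖ε • lastVec d - y‖ ^ (d + 1))⁻¹ ≤ ((1 / 16 : ℝ) ^ (d + 1))⁻¹ :=
          inv_anti₀ (by positivity) this
      _ = 16 ^ (d + 1) := by rw [one_div, inv_pow, inv_inv]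
  have h5 : 0 ≤ (‖ε • lastVec d - y‖ ^ (d + 1))⁻¹ := by positivity
  rw [vertKernel]
  calc (‖ε • lastVec d - y‖ ^ (d + 1))⁻¹ * (ε - vert y)
      ≤ (‖ε • lastVec d - y‖ ^ (d + 1))⁻¹ * 2 := by gcongr; linarith
    _ ≤ 2 * 16 ^ (d + 1) := by linarith

lemma measurable_vert : Measurable (vert (d := d)) := by
  unfold vert; fun_prop

lemma measurable_vertKernel (ε : ℝ) : Measurable (vertKernel (d := d) ε) := by
  have h1 : Measurable fun y : EuclideanSpace ℝ (Fin (d + 1)) => ‖ε • lastVec d - y‖ :=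
    (continuous_const.sub continuous_id).norm.measurable
  exact ((h1.pow_const _).inv).mul (measurable_const.sub measurable_vert)

/-- At `ε = 0` the majorant vanishes and only the contribution of `-y_n` is left. -/
lemma tendsto_vertKernel {y : EuclideanSpace ℝ (Fin (d + 1))} (hy : y ≠ 0) :
    Tendsto (fun ε : ℝ => 2 ^ (d + 1) * (ε / max ‖ε • lastVec d - y‖ ε ^ (d + 1)) -
      vertKernel ε y) (𝓝[>] 0) (𝓝 (vert y / ‖y‖ ^ (d + 1))) := by
  have hy0 : 0 < ‖y‖ := norm_pos_iff.2 hy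
  have hc : ContinuousAt (fun ε : ℝ => 2 ^ (d + 1) * (ε / max ‖ε • lastVec d - y‖ ε ^ (d + 1)) -
      vertKernel ε y) 0 := by
    unfold vertKernel
    refine ContinuousAt.sub (continuousAt_const.mul (ContinuousAt.div continuousAt_id
      (by fun_prop) ?_)) (ContinuousAt.mul (ContinuousAt.inv₀ (by fun_prop) ?_) (by fun_prop))
    · simp [hy]
    · simp [hy]
  have h2 := hc.tendsto.mono_left (nhdsWithin_le_nhds (s := Ioi (0 : ℝ)))
  convert h2 using 2
  simp [vertKernel, inv_mul_eq_div]

/-- The pointwise limit of the kernels dominates a function which is not integrable. -/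
lemma IsLogCusp.le_vert_div_norm_pow (h : IsLogCusp Γ) {y : EuclideanSpace ℝ (Fin (d + 1))}
    (hy : y ∈ Γ) (hy8 : y ∈ ball (0 : EuclideanSpace ℝ (Fin (d + 1))) (1 / 8)) :
    (2 ^ (d + 1))⁻¹ * ((‖horiz y‖ ^ d)⁻¹ / |Real.log ‖horiz y‖|) ≤ vert y / ‖y‖ ^ (d + 1) := by
  obtain ⟨hv, h8, hv0, hv2⟩ := h.vert_eq hy hy8
  -- On the axis `log 0 = 0` and division by zero make the left side `0`.
  rcases (norm_nonneg (horiz y)).eq_or_lt with h0 | h0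
  · rw [← h0]
    simp only [Real.log_zero, abs_zero, div_zero, mul_zero]
    positivity
  · have hL := two_le_abs_log h0 h8
    have hyn : ‖y‖ ≤ 2 * ‖horiz y‖ := by
      have := norm_le_horiz_add_vert y
      rw [abs_of_nonneg hv0] at this
      linarith
    have hy0 : 0 < ‖y‖ := h0.trans_le (norm_horiz_le y)
    rw [hv]
    set r := ‖horiz y‖
    have h3 : ‖y‖ ^ (d + 1) ≤ 2 ^ (d + 1) * r ^ (d + 1) := by
      rw [← mul_pow]; exact pow_le_pow_left₀ hy0.le hyn _
    calc (2 ^ (d + 1))⁻¹ * ((r ^ d)⁻¹ / |Real.log r|)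
        = r / |Real.log r| / (2 ^ (d + 1) * r ^ (d + 1)) := by
          rw [pow_succ r]
          have : |Real.log r| ≠ 0 := by linarith
          field_simp
      _ ≤ r / |Real.log r| / ‖y‖ ^ (d + 1) := by gcongr

/-- The projection of the surface measure of the graph dominates Lebesgue measure. -/
lemma IsLogCusp.volume_le_map_horiz (h : IsLogCusp Γ) :
    (volume : Measure (EuclideanSpace ℝ (Fin d))).restrict (ball 0 (1 / 16)) ≤
      ((μHE[d].restrict Γ).restrict (ball 0 (1 / 8))).map horiz := by
  refine Measure.le_iff.2 fun S hS => ?_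
  have hm : Measurable (horiz (d := d)) := lipschitzWith_horiz.continuous.measurable
  rw [Measure.restrict_apply hS, Measure.map_apply hm hS, Measure.restrict_apply (hm hS),
    Measure.restrict_apply ((hm hS).inter measurableSet_ball),
    ← EuclideanSpace.euclideanHausdorffMeasure_eq_volume]
  -- A base point with `‖z‖ < 1 / 16` lifts to a point of `Γ` of norm below `1 / 16 + 1 / 32 < 1 /
  -- 8`. Projecting back is 1-Lipschitz and cannot increase the Hausdorff measure.
  have himg : S ∩ ball 0 (1 / 16) ⊆ horiz '' (horiz ⁻¹' S ∩ ball 0 (1 / 8) ∩ Γ) := by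
    rintro z ⟨hzS, hz⟩
    have hz' : ‖z‖ < 1 / 16 := by simpa using hz
    have hhalf := div_abs_log_le_half (norm_nonneg z) (by linarith)
    have hnn : 0 ≤ ‖z‖ / |Real.log ‖z‖| := by positivity
    set y := ofHorizVert z (‖z‖ / |Real.log ‖z‖|) with hy
    have hyn : ‖y‖ < 1 / 8 := by
      have := norm_le_horiz_add_vert y
      rw [hy, horiz_ofHorizVert, vert_ofHorizVert, abs_of_nonneg hnn, ← hy] at this
      linarith
    have hyΓ : y ∈ Γ ∩ ball 0 (1 / 4) := by
      rw [h]
      refine ⟨?_, by simp [hy]⟩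
      simp only [mem_ball, dist_zero_right]
      linarith
    exact ⟨y, ⟨⟨by simpa [hy] using hzS, by simpa using hyn⟩, hyΓ.1⟩, by simp [hy]⟩
  refine (measure_mono himg).trans ?_
  have := euclideanHausdorffMeasure_image_le
    (lipschitzWith_horiz.lipschitzOnWith (s := horiz ⁻¹' S ∩ ball 0 (1 / 8) ∩ Γ)) d
  simpa using this

lemma IsLogCusp.lintegral_eq_top (h : IsLogCusp Γ) (hd : 1 ≤ d) :
    ∫⁻ y in ball 0 (1 / 8), ENNReal.ofReal
      ((2 ^ (d + 1))⁻¹ * ((‖horiz y‖ ^ d)⁻¹ / |Real.log ‖horiz y‖|)) ∂(μHE[d].restrict Γ) = ⊤ := by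
  have hm : Measurable (horiz (d := d)) := lipschitzWith_horiz.continuous.measurable
  have hq : Measurable fun z : EuclideanSpace ℝ (Fin d) =>
      ENNReal.ofReal ((2 ^ (d + 1))⁻¹ * ((‖z‖ ^ d)⁻¹ / |Real.log ‖z‖|)) :=
    (measurable_const.mul (((measurable_norm.pow_const d).inv).div
      (continuous_abs.measurable.comp (Real.measurable_log.comp measurable_norm)))).ennreal_ofReal
  rw [eq_top_iff, ← lintegral_map (f := fun z : EuclideanSpace ℝ (Fin d) =>
      ENNReal.ofReal ((2 ^ (d + 1))⁻¹ * ((‖z‖ ^ d)⁻¹ / |Real.log ‖z‖|))) hq hm]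
  refine le_trans ?_ (lintegral_mono' h.volume_le_map_horiz le_rfl)
  simp_rw [ENNReal.ofReal_mul (show (0 : ℝ) ≤ (2 ^ (d + 1))⁻¹ by positivity)]
  rw [lintegral_const_mul' _ _ ENNReal.ofReal_ne_top,
    lintegral_norm_pow_div_log_eq_top hd (by norm_num), ENNReal.mul_top]
  simp

/-- The vertical derivative of the Newtonian potential of a log cusp diverges. -/
lemma IsLogCusp.tendsto_integral_vertKernel (h : IsLogCusp Γ) (hd : 1 ≤ d) (hΓm : MeasurableSet Γ)
    {C : ℝ} (hC : 0 ≤ C) (hg : HasGrowth (μHE[d].restrict Γ) C d)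
    [IsFiniteMeasure (μHE[d].restrict Γ)]
    (hΓ1 : ∀ y ∈ Γ, ‖y‖ ≤ 1)
    (hint : ∀ᶠ ε : ℝ in 𝓝[>] 0, Integrable (vertKernel ε) (μHE[d].restrict Γ)) :
    Tendsto (fun ε : ℝ => ∫ y, vertKernel ε y ∂(μHE[d].restrict Γ)) (𝓝[>] 0) atBot := by
  set μ : Measure (EuclideanSpace ℝ (Fin (d + 1))) := μHE[d].restrict Γ with hμ
  set N : Set (EuclideanSpace ℝ (Fin (d + 1))) := ball 0 (1 / 8) with hN
  have hNm : MeasurableSet N := measurableSet_ball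
  have hΓae : ∀ᵐ y ∂μ, y ∈ Γ := ae_restrict_mem hΓm
  have hNae : ∀ᵐ y ∂μ.restrict N, y ∈ Γ ∧ y ∈ N :=
    (ae_restrict_of_ae hΓae).and (ae_restrict_mem hNm)
  set P : ℝ → EuclideanSpace ℝ (Fin (d + 1)) → ℝ := fun ε y =>
    2 ^ (d + 1) * (ε / max ‖ε • lastVec d - y‖ ε ^ (d + 1)) with hP
  have hPm : ∀ ε, Measurable (P ε) := fun ε => by
    have h1 : Measurable fun y : EuclideanSpace ℝ (Fin (d + 1)) => ‖ε • lastVec d - y‖ :=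
      (continuous_const.sub continuous_id).norm.measurable
    exact measurable_const.mul (measurable_const.div ((h1.max measurable_const).pow_const _))
  -- Fatou's lemma for majorant minus kernel, whose pointwise limit dominates a function of infinite
  -- integral.
  have hfatou : liminf (fun ε : ℝ => ∫⁻ y in N, ENNReal.ofReal (P ε y - vertKernel ε y) ∂μ)
      (𝓝[>] 0) = ⊤ := by
    rw [eq_top_iff, ← h.lintegral_eq_top hd]
    refine le_trans (lintegral_mono_ae ?_) (lintegral_liminf_le fun ε =>
      ((hPm ε).sub (measurable_vertKernel ε)).ennreal_ofReal)
    filter_upwards [hNae] with y hy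
    by_cases hy0 : y = 0
    · subst hy0
      have : horiz (0 : EuclideanSpace ℝ (Fin (d + 1))) = 0 := by ext i; simp [horiz]
      simp [this]
    · have ht := ENNReal.tendsto_ofReal (tendsto_vertKernel hy0)
      rw [ht.liminf_eq]
      exact ENNReal.ofReal_le_ofReal (h.le_vert_div_norm_pow hy.1 hy.2)
  rw [tendsto_atBot]
  intro b
  set B : ℝ := 2 * 16 ^ (d + 1) * μ.real univ
  set A : ℝ := 2 ^ (d + 1) * (C * (d + 1))
  -- `A` bounds the majorant and `B` the integral away from the origin. Exceeding `A + B - b` forces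
  -- the near part below `b - B`, hence the whole integral below `b`.
  have hev : ∀ᶠ ε : ℝ in 𝓝[>] 0, ENNReal.ofReal (A + B - b) <
      ∫⁻ y in N, ENNReal.ofReal (P ε y - vertKernel ε y) ∂μ :=
    eventually_lt_of_lt_liminf (by rw [hfatou]; exact ENNReal.ofReal_lt_top)
  have h16 : ∀ᶠ ε : ℝ in 𝓝[>] 0, ε < 1 / 16 :=
    nhdsWithin_le_nhds (gt_mem_nhds (by norm_num))
  filter_upwards [hev, hint, self_mem_nhdsWithin, h16] with ε hε1 hεi hε0 hε16
  have hε : 0 < ε := hε0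
  obtain ⟨hQi, hQ⟩ := hg.integral_div_max_pow_le hC hε (ε • lastVec d)
  have hPi : Integrable (P ε) μ := hQi.const_mul _
  have hPle : ∫ y in N, P ε y ∂μ ≤ A := by
    refine (setIntegral_le_integral hPi (Eventually.of_forall fun y => ?_)).trans ?_
    · have : 0 < max ‖ε • lastVec d - y‖ ε := lt_max_of_lt_right hε
      simp only [hP, Pi.zero_apply]
      positivity
    · simp only [hP]
      rw [integral_const_mul]
      exact mul_le_mul_of_nonneg_left hQ (by positivity)
  rw [← ofReal_integral_eq_lintegral_ofReal (f := fun y => P ε y - vertKernel ε y)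
    (hPi.integrableOn.sub hεi.integrableOn)
    (hNae.mono fun y hy => sub_nonneg.2 (h.vertKernel_le_near hy.1 hy.2 hε))] at hε1
  have hlt := lt_of_not_ge fun hge => absurd hε1 (not_lt.2 (ENNReal.ofReal_le_ofReal hge))
  rw [integral_sub hPi.integrableOn hεi.integrableOn] at hlt
  have hfar : ∫ y in Nᶜ, vertKernel ε y ∂μ ≤ B := by
    calc ∫ y in Nᶜ, vertKernel ε y ∂μ ≤ ∫ y in Nᶜ, 2 * 16 ^ (d + 1) ∂μ := by
          refine integral_mono_ae hεi.integrableOn (integrable_const _) ?_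
          filter_upwards [ae_restrict_of_ae hΓae, ae_restrict_mem hNm.compl] with y hy1 hy2
          exact vertKernel_le_far hε.le hε16.le (hΓ1 y hy1) hy2
      _ ≤ ∫ y, 2 * 16 ^ (d + 1) ∂μ := setIntegral_le_integral (integrable_const _)
          (Eventually.of_forall fun _ => by simp only [Pi.zero_apply]; positivity)
      _ = B := by rw [integral_const, smul_eq_mul, mul_comm]
  rw [← integral_add_compl hNm hεi]
  linarith

end LogCusp

/-! ### The normalized potential as the solution -/

section Solution

variable {d : ℕ} {Γ : Set (EuclideanSpace ℝ (Fin (d + 1)))}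

lemma isFiniteMeasure_of_hasGrowth {C : ℝ}
    (hg : HasGrowth (μHE[d].restrict Γ) C d) (hsub : Γ ⊆ ball 0 1) :
    IsFiniteMeasure (μHE[d].restrict Γ) := by
  refine ⟨?_⟩
  have h1 := hg 0 1 zero_le_one
  rw [Measure.restrict_apply measurableSet_closedBall,
    inter_eq_right.2 (hsub.trans ball_subset_closedBall)] at h1
  rw [Measure.restrict_apply_univ]
  exact h1.trans_lt ENNReal.ofReal_lt_top

/-- The solution of the surface Poisson problem in the unit ball, given by the Green potential of
the surface measure. -/
noncomputable def surfaceSolution (Γ : Set (EuclideanSpace ℝ (Fin (d + 1))))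
    (x : EuclideanSpace ℝ (Fin (d + 1))) : ℝ :=
  (∫ z : EuclideanSpace ℝ (Fin (d + 1)), bubble (d + 1) z)⁻¹ *
    greenPotential (d + 1) (μHE[d].restrict Γ) 0 x

lemma finrank_euclidean : Module.finrank ℝ (EuclideanSpace ℝ (Fin (d + 1))) = d + 1 := by simp

lemma cast_finrank_euclidean :
    ((Module.finrank ℝ (EuclideanSpace ℝ (Fin (d + 1))) : ℕ) : ℝ) = d + 1 := by simp

lemma integral_bubble_euclidean_pos :
    0 < ∫ z : EuclideanSpace ℝ (Fin (d + 1)), bubble (d + 1) z := by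
  rw [← cast_finrank_euclidean]
  exact integral_bubble_pos

lemma isDistributionalSolution_surfaceSolution (hd : 1 ≤ d) {C ρ : ℝ} (hC : 0 ≤ C)
    (hg : HasGrowth (μHE[d].restrict Γ) C d) [IsFiniteMeasure (μHE[d].restrict Γ)] (hρ : ρ < 1)
    (hμ : ∀ᵐ y ∂(μHE[d].restrict Γ), y ∈ closedBall 0 ρ) :
    IsDistributionalSolution (ball 0 1) Γ (fun _ => 1) (surfaceSolution Γ) where
  continuousOn := by
    rw [closure_ball _ one_ne_zero]
    exact continuousOn_const.mul (continuousOn_greenPotential_zero hd hg hC hρ hμ)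
  eq_zero_on_frontier x hx := by
    rw [frontier_ball _ one_ne_zero] at hx
    have hx1 : ‖x‖ = 1 := by simpa using hx
    simp [surfaceSolution, greenPotential, greenKernel_zero_of_norm_eq_one hx1]
  weak_eq φ hφ hc hφs := by
    have h := setIntegral_greenPotential_mul_laplacian finrank_euclidean hd hg hC hρ hμ
      (hφ.of_le two_le_infty) hc hφs
    rw [cast_finrank_euclidean] at h
    simp_rw [surfaceSolution, mul_assoc, one_mul]
    rw [integral_const_mul, h, inv_mul_cancel_left₀ integral_bubble_euclidean_pos.ne']

/-- At points of the vertical axis close to the origin every solution is differentiable, with a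
vertical derivative controlled by `vertKernel`. -/
lemma exists_hasFDerivAt_solution (hd : 1 ≤ d) (hΓm : MeasurableSet Γ) (hcusp : IsLogCusp Γ)
    {C ρ : ℝ} (hC : 0 ≤ C) (hg : HasGrowth (μHE[d].restrict Γ) C d)
    [IsFiniteMeasure (μHE[d].restrict Γ)] (hρ : ρ < 1)
    (hμ : ∀ᵐ y ∂(μHE[d].restrict Γ), y ∈ closedBall 0 ρ)
    {u : EuclideanSpace ℝ (Fin (d + 1)) → ℝ}
    (hu : IsDistributionalSolution (ball 0 1) Γ (fun _ => 1) u) {ε : ℝ} (hε : 0 < ε)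
    (hε16 : ε < 1 / 16) :
    Integrable (vertKernel ε) (μHE[d].restrict Γ) ∧
    ∃ L : EuclideanSpace ℝ (Fin (d + 1)) →L[ℝ] ℝ, HasFDerivAt u L (ε • lastVec d) ∧
      L (lastVec d) ≤ (∫ z : EuclideanSpace ℝ (Fin (d + 1)), bubble (d + 1) z)⁻¹ *
        (2 * ∫ y, vertKernel ε y ∂(μHE[d].restrict Γ) +
          4 * ((1 - ρ) ^ 2) ^ (-(((d : ℝ) + 1) / 2)) * (μHE[d].restrict Γ).real univ) := by
  have hx : ‖ε • lastVec d‖ < 1 := by rw [norm_smul_lastVec hε.le]; linarith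
  have hfar : ∀ᵐ y ∂(μHE[d].restrict Γ), ε / 2 ≤ ‖ε • lastVec d - y‖ :=
    (ae_restrict_mem hΓm).mono fun y hy => hcusp.half_le_norm_sub hy hε.le hε16.le
  obtain ⟨hi, L, hL, hLv⟩ := exists_hasFDerivAt_greenPotential (n := (d : ℝ) + 1) (by positivity) hρ
    hμ hx (half_pos hε) hfar
    (integrable_greenKernel_zero hd hg hC hρ hμ (by simpa using hx.le)) (lastVec d)
  simp_rw [rpow_mul_inner_eq_vertKernel] at hi hLv
  rw [norm_lastVec, mul_one] at hLv
  refine ⟨hi, (∫ z : EuclideanSpace ℝ (Fin (d + 1)), bubble (d + 1) z)⁻¹ • L, ?_, ?_⟩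
  · have hsol := isDistributionalSolution_surfaceSolution hd hC hg hρ hμ
    -- By uniqueness an arbitrary solution coincides with the potential near this interior point and
    -- inherits its derivative.
    have heq : u =ᶠ[𝓝 (ε • lastVec d)] surfaceSolution Γ := by
      filter_upwards [isOpen_ball.mem_nhds (show ε • lastVec d ∈ ball 0 1 by simpa using hx)]
        with z hz using hu.eqOn hsol (subset_closure hz)
    exact (hL.const_mul _).congr_of_eventuallyEq heq
  · rw [_root_.smul_apply, smul_eq_mul]
    exact mul_le_mul_of_nonneg_left hLv (inv_nonneg.2 integral_bubble_euclidean_pos.le)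

end Solution

/-- A function with unbounded vertical derivatives along the axis is not locally Lipschitz. -/
lemma not_locallyLipschitzOn_of_tendsto_lineDeriv {d : ℕ}
    {u : EuclideanSpace ℝ (Fin (d + 1)) → ℝ}
    (hdiff : ∀ᶠ ε : ℝ in 𝓝[>] 0, DifferentiableAt ℝ u (ε • lastVec d))
    (hlim : Tendsto (fun ε : ℝ => lineDeriv ℝ u (ε • lastVec d) (lastVec d)) (𝓝[>] 0) atBot) :
    ¬ LocallyLipschitzOn (ball 0 1) u := fun hlip => by
  obtain ⟨K, t, ht, hK⟩ := hlip (mem_ball_self one_pos)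
  rw [isOpen_ball.nhdsWithin_eq (mem_ball_self one_pos)] at ht
  have hx : Tendsto (fun ε : ℝ => ε • lastVec d) (𝓝[>] 0) (𝓝 0) := by
    have hc : Continuous fun ε : ℝ => ε • lastVec d := by fun_prop
    simpa using (hc.tendsto 0).mono_left (nhdsWithin_le_nhds (s := Ioi (0 : ℝ)))
  obtain ⟨ε, h1, h2, h3⟩ := (hdiff.and ((hx.eventually (eventually_mem_nhds_iff.2 ht)).and
    (hlim.eventually_lt_atBot (-(K : ℝ))))).exists
  rw [h1.lineDeriv_eq_fderiv] at h3
  have h4 : ‖fderiv ℝ u (ε • lastVec d)‖ ≤ K := h1.hasFDerivAt.le_of_lipschitzOn h2 hK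
  have h5 := (fderiv ℝ u (ε • lastVec d)).le_opNorm (lastVec d)
  rw [norm_lastVec, mul_one, Real.norm_eq_abs] at h5
  linarith [neg_abs_le (fderiv ℝ u (ε • lastVec d) (lastVec d))]

end SurfacePoisson

/-! ### Assembly of the theorem -/

theorem theorem3p1 (d : ℕ) (hd : 2 ≤ d + 1)
    (Γ : Set (EuclideanSpace ℝ (Fin (d + 1))))
    (hΓ : SurfacePoisson.IsClosedC1Hypersurface Γ)
    (hΓ_sub : Γ ⊆ ball (0 : EuclideanSpace ℝ (Fin (d + 1))) 1)
    (hΓ_graph : Γ ∩ ball (0 : EuclideanSpace ℝ (Fin (d + 1))) (1 / 4) =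
      {x | x ∈ ball (0 : EuclideanSpace ℝ (Fin (d + 1))) (1 / 4) ∧
        SurfacePoisson.vert x =
          ‖SurfacePoisson.horiz x‖ / |Real.log ‖SurfacePoisson.horiz x‖|}) :
    (∃ u : EuclideanSpace ℝ (Fin (d + 1)) → ℝ,
      SurfacePoisson.IsDistributionalSolution (ball 0 1) Γ (fun _ => 1) u) ∧
    (∀ u v : EuclideanSpace ℝ (Fin (d + 1)) → ℝ,
      SurfacePoisson.IsDistributionalSolution (ball 0 1) Γ (fun _ => 1) u →
      SurfacePoisson.IsDistributionalSolution (ball 0 1) Γ (fun _ => 1) v →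
      EqOn u v (closure (ball 0 1))) ∧
    (∀ u : EuclideanSpace ℝ (Fin (d + 1)) → ℝ,
      SurfacePoisson.IsDistributionalSolution (ball 0 1) Γ (fun _ => 1) u →
      (∀ᶠ ε : ℝ in 𝓝[>] 0, DifferentiableAt ℝ u (ε • SurfacePoisson.lastVec d)) ∧
      Tendsto
        (fun ε : ℝ => lineDeriv ℝ u (ε • SurfacePoisson.lastVec d) (SurfacePoisson.lastVec d))
        (𝓝[>] 0) atBot ∧
      ¬ LocallyLipschitzOn (ball 0 1) u) := by
  have hd1 : 1 ≤ d := by omega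
  have hΓm : MeasurableSet Γ := hΓ.1.measurableSet
  obtain ⟨C, hC, hg⟩ := hΓ.exists_hasGrowth
  have := SurfacePoisson.isFiniteMeasure_of_hasGrowth hg hΓ_sub
  -- Compactness keeps `Γ` inside a ball of radius `ρ < 1`, which bounds the reflected quadratic
  -- below by `(1 - ρ)²` up to the boundary.
  obtain ⟨ρ, hρ, hΓρ⟩ := exists_lt_subset_ball hΓ.1.isClosed hΓ_sub
  have hμ : ∀ᵐ y ∂((μHE[d] : Measure (EuclideanSpace ℝ (Fin (d + 1)))).restrict Γ),
      y ∈ closedBall 0 ρ := (ae_restrict_mem hΓm).mono fun y hy => ball_subset_closedBall (hΓρ hy)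
  have hcusp : SurfacePoisson.IsLogCusp Γ := hΓ_graph
  refine ⟨⟨_, SurfacePoisson.isDistributionalSolution_surfaceSolution hd1 hC hg hρ hμ⟩,
    fun u v hu hv => hu.eqOn hv, fun u hu => ?_⟩
  have h16 : ∀ᶠ ε : ℝ in 𝓝[>] 0, 0 < ε ∧ ε < 1 / 16 :=
    Ioo_mem_nhdsGT (by norm_num)
  have hker := h16.mono fun ε hε =>
    SurfacePoisson.exists_hasFDerivAt_solution hd1 hΓm hcusp hC hg hρ hμ hu hε.1 hε.2
  have hdiff : ∀ᶠ ε : ℝ in 𝓝[>] 0, DifferentiableAt ℝ u (ε • SurfacePoisson.lastVec d) :=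
    hker.mono fun ε ⟨_, L, hL, _⟩ => hL.differentiableAt
  have hlim : Tendsto
      (fun ε : ℝ => lineDeriv ℝ u (ε • SurfacePoisson.lastVec d) (SurfacePoisson.lastVec d))
      (𝓝[>] 0) atBot := by
    have h1 := hcusp.tendsto_integral_vertKernel hd1 hΓm hC hg
      (fun y hy => le_of_lt (by simpa using hΓ_sub hy)) (hker.mono fun ε h => h.1)
    refine tendsto_atBot_mono' _ (hker.mono fun ε ⟨_, L, hL, hLv⟩ => ?_)
      ((tendsto_atBot_add_const_right _
        (4 * ((1 - ρ) ^ 2) ^ (-(((d : ℝ) + 1) / 2)) *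
          ((μHE[d] : Measure (EuclideanSpace ℝ (Fin (d + 1)))).restrict Γ).real univ)
        (h1.const_mul_atBot two_pos)).const_mul_atBot
        (inv_pos.2 (SurfacePoisson.integral_bubble_euclidean_pos (d := d))))
    beta_reduce
    rw [hL.differentiableAt.lineDeriv_eq_fderiv, hL.fderiv]
    exact hLv
  exact ⟨hdiff, hlim, SurfacePoisson.not_locallyLipschitzOn_of_tendsto_lineDeriv hdiff hlim⟩
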